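/- Let $N\ge 1$, let $\Delta^N=\{w\in\mathbb R_{\ge 0}^N:\sum_i w_i=1\}$, and let $b\in\Delta^N$ have strictly positive entries. For $w,u\in\Delta^N$ let $D_{\mathrm{KL}}(w\|u)=\sum_i w_i\log(w_i/u_i)\in[0,\infty]$, with $0\log(0/u_i)=0$ and value $+\infty$ if $w_i>0=u_i$ for some $i$. For a closed convex set $C\subseteq\mathbb R^N$, the KL projection $\Pi^{\mathrm{KL}}_C(u)$ is the minimizer of $D_{\mathrm{KL}}(w\|u)$ over $w\in C\cap\Delta^N$ (with finite minimal value). Write $\mathrm{normalize}(v)=v/\sum_i v_i$, and let $\odot,\oslash$ be the entrywise product and quotient. (i) Let $K\ge 1$, $X\in\mathbb R^{N\times K}$ with columns $a_1,\dots,a_K$, and $t\in\mathbb R^K$, and suppose that some $w\in\Delta^N$ satisfies $X^\top w=t$. Then $D_{\mathrm{KL}}(\cdot\|b)$ has a unique minimizer $w^\star$ over $\{w\in\Delta^N: X^\top w=t\}$. The cyclic one-dimensional KL projections $w^{0}=b$, $w^{n+1}=\Pi^{\mathrm{KL}}_{\{w:\,a_k^\top w=t_k\}}(w^{n})$, with $k=(n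 \bmod K)+1$, are well defined (each projection exists and is unique), and $w^{n}\to w^\star$. Likewise, $w^n\to w^\star$ for every sequence with $w^0=b$ and $w^{n+1}=\mathrm{normalize}(w^n\odot e^{\alpha_n a_k})$, where $k=(n\bmod K)+1$ and $\alpha_n\in\mathbb R$ is such that $a_k^\top w^{n+1}=t_k$. (ii) Let $J\ge 1$ and let $C_1,\dots,C_J\subseteq\mathbb R^N$ be closed convex sets with $\Delta^N\cap\bigcap_j C_j\ne\emptyset$. Suppose that either every $C_j$ is of the form $\{w:a^\top w=\tau\}$ or $\{w:a^\top w\le\tau\}$ with $a\in\mathbb R^N$, $\tau\in\mathbb R$, or $\Delta^N\cap\bigcap_j C_j$ contains a point with strictly positive entries. Start with $w=b$ and $q_1=\dots=q_J=\mathbf 1$, and let $j$ run cyclically through $1,\dots,J$; in each step put $z=\Pi^{\mathrm{KL}}_{C_j}(\mathrm{normalize}(w\odot q_j))$, then replace $q_j$ by $(w\odot q_j)\oslash z$ and $w$ by $z$ (entries of the quotient at which $z_i=0$ are set to $0$; they do not influence the later iterates $w$). Then $b$ has a unique KL projection onto $\bigcap_j C_j$, all steps of this Bregman-Dykstra scheme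 are well defined (each projection exists and is unique), and the iterates $w$ converge to $\Pi^{\mathrm{KL}}_{\bigcap_j C_j}(b)$. -/

import Mathlib

open Filter Topology

noncomputable section

/-- The Kullback-Leibler divergence `∑ i, w i * log (w i / u i)` of nonnegative vectors, with the
usual conventions `0 * log (0 / u) = 0` and `w * log (w / 0) = ∞` for `w > 0`. -/
def klDist {N : ℕ} (w u : Fin N → ℝ) : EReal :=
  open Classical in
  if ∀ i, u i = 0 → w i = 0 then ((∑ i, w i * Real.log (w i / u i) : ℝ) : EReal) else ⊤

/-- `p` minimizes `w ↦ KL(w ‖ u)` over the points of `C` in the probability simplex, with a finite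
minimal value; that is, `p` is the KL projection of `u` onto `C`. -/
def IsKLProj {N : ℕ} (C : Set (Fin N → ℝ)) (u p : Fin N → ℝ) : Prop :=
  p ∈ C ∩ stdSimplex ℝ (Fin N) ∧ klDist p u ≠ ⊤ ∧
    ∀ w ∈ C ∩ stdSimplex ℝ (Fin N), klDist p u ≤ klDist w u

/-- `v / (𝟏ᵀ v)`. -/
def normalizeVec {N : ℕ} (v : Fin N → ℝ) : Fin N → ℝ := fun i => v i / ∑ l, v l

/-- The hyperplane `aᵀ w = τ`. -/
def linHyperplane {N : ℕ} (a : Fin N → ℝ) (τ : ℝ) : Set (Fin N → ℝ) := {w | a ⬝ᵥ w = τ}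

/-- The half-space `aᵀ w ≤ τ`. -/
def linHalfspace {N : ℕ} (a : Fin N → ℝ) (τ : ℝ) : Set (Fin N → ℝ) := {w | a ⬝ᵥ w ≤ τ}

/-- The sequence of all iterates of the cyclic KL projections, started at `b`, onto the
hyperplanes given by the columns of `X` and the entries of `t`.  Step `n` uses the constraint
with index `n` modulo `K`. -/
structure IsCyclicKLProj {N K : ℕ} [NeZero K] (X : Matrix (Fin N) (Fin K) ℝ) (t : Fin K → ℝ)
    (b : Fin N → ℝ) (w : ℕ → Fin N → ℝ) : Prop where
  w_zero : w 0 = b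
  w_succ : ∀ n, IsKLProj (linHyperplane (fun i => X i (Fin.ofNat K n)) (t (Fin.ofNat K n)))
    (w n) (w (n + 1))

/-- The same cycle with each step written as a one-dimensional solve: `w` is replaced by
`normalize (w ⊙ exp (α a))`, where `α` is a root of `aᵀ (normalize (w ⊙ exp (α a))) = τ`. -/
structure IsCyclicTilt {N K : ℕ} [NeZero K] (X : Matrix (Fin N) (Fin K) ℝ) (t : Fin K → ℝ)
    (b : Fin N → ℝ) (w : ℕ → Fin N → ℝ) : Prop where
  w_zero : w 0 = b
  w_succ : ∀ n, ∃ α : ℝ,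
    w (n + 1) = normalizeVec (fun i => w n i * Real.exp (α * X i (Fin.ofNat K n))) ∧
    w (n + 1) ∈ linHyperplane (fun i => X i (Fin.ofNat K n)) (t (Fin.ofNat K n))

/-- The iterates `w` and correction terms `q` of the Bregman-Dykstra scheme with the KL divergence,
started at `b`; step `n` uses the set with index `j = n` modulo `J`:
`z = Π_{C j} (normalize (w ⊙ q j))`, then `q j ← (w ⊙ q j) ⊘ z` and `w ← z`.
Entries of `q j` at which `z` vanishes get the value `0` here; they never influence the iterates,
since a zero entry of `w` stays zero. -/
structure IsBregmanDykstra {N J : ℕ} [NeZero J] (C : Fin J → Set (Fin N → ℝ))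
    (b : Fin N → ℝ) (w : ℕ → Fin N → ℝ) (q : ℕ → Fin J → Fin N → ℝ) : Prop where
  w_zero : w 0 = b
  q_zero : q 0 = fun _ _ => 1
  w_succ : ∀ n, IsKLProj (C (Fin.ofNat J n)) (normalizeVec (w n * q n (Fin.ofNat J n))) (w (n + 1))
  q_succ : ∀ n, q (n + 1) =
    Function.update (q n) (Fin.ofNat J n) (w n * q n (Fin.ofNat J n) / w (n + 1))

end

/-!
Both methods are coordinate ascent on the dual problem. Each step raises the dual value by at least
`KL(new iterate ‖ old iterate)`, and the dual values are at most `KL(v ‖ b)` for every feasible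
`v`. By a Pinsker-type inequality the steps are square summable, so the distances between
consecutive iterates tend to `0` and every cluster point `y` of the iterates is feasible. Since
`KL(x ‖ w n)` is at most the duality gap at a feasible `x`, everything reduces to closing the gap
at one cluster point `y`: then `y` is optimal and the entire sequence converges to it.

For hyperplanes the Pythagorean identity is exact, and the gap at `y` is `KL(y ‖ w n)`. For
half-spaces, the constraints that are inactive at `y` are inactive near `y`, so complementary
slackness holds along the subsequence. If the feasible set meets the relative interior of the face
of `b`, then the iterates stay away from the boundary of that face, so the logarithms of the
corrections grow at most like the length of the path of `w`. By Cauchy-Schwarz this length is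
`O(√n)`, whereas the lengths of the last cycles of steps are square summable; since the harmonic
series diverges, the product of the two is arbitrarily small for suitable `n`.
-/

open Function (support)

section RealInequalities

variable {x y : ℝ}

theorem sq_sub_le_four_mul_sq_sqrt_sub_sqrt (hx : x ∈ Set.Icc 0 1) (hy : y ∈ Set.Icc 0 1) :
    (x - y) ^ 2 ≤ 4 * (√x - √y) ^ 2 := by
  have hfactor : x - y = (√x + √y) * (√x - √y) := by
    rw [← sq_sub_sq, Real.sq_sqrt hx.1, Real.sq_sqrt hy.1]
  have hsum : √x + √y ≤ 2 := by
    linarith [Real.sqrt_le_one.2 hx.2, Real.sqrt_le_one.2 hy.2]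
  calc (x - y) ^ 2 = (√x + √y) ^ 2 * (√x - √y) ^ 2 := by rw [hfactor, mul_pow]
    _ ≤ 2 ^ 2 * (√x - √y) ^ 2 := by gcongr
    _ = 4 * (√x - √y) ^ 2 := by norm_num

theorem sq_sqrt_sub_sqrt_le_mul_log_div (hx : 0 ≤ x) (hy : 0 ≤ y) (h : x ≠ 0 → y ≠ 0) :
    (√x - √y) ^ 2 ≤ x * Real.log (x / y) - x + y := by
  rcases hx.eq_or_lt with rfl | hx0
  · simp [Real.sq_sqrt hy]
  have hy0 : 0 < y := hy.lt_of_ne' (h hx0.ne')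
  have hlog : Real.log (x / y) = -2 * Real.log (√y / √x) := by
    rw [← Real.sqrt_div hy, Real.log_sqrt (by positivity), ← inv_div y x, Real.log_inv]
    ring
  have hbound : x * Real.log (√y / √x) ≤ √x * √y - x := by
    calc x * Real.log (√y / √x) ≤ x * (√y / √x - 1) := by
          gcongr
          exact Real.log_le_sub_one_of_pos (by positivity)
      _ = √x * √y - x := by rw [mul_sub, mul_one, mul_div_left_comm, Real.div_sqrt, mul_comm]
  rw [hlog, sub_sq, Real.sq_sqrt hx, Real.sq_sqrt hy]
  linarith

theorem log_sub_log_le_abs_sub_div {κ : ℝ} (hκ : 0 < κ) (hx : κ ≤ x) (hy : κ ≤ y) :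
    Real.log x - Real.log y ≤ |x - y| / κ := by
  have hx0 := hκ.trans_le hx
  have hy0 := hκ.trans_le hy
  calc Real.log x - Real.log y = Real.log (x / y) := (Real.log_div hx0.ne' hy0.ne').symm
    _ ≤ x / y - 1 := Real.log_le_sub_one_of_pos (by positivity)
    _ = (x - y) / y := by rw [sub_div, div_self hy0.ne']
    _ ≤ |x - y| / κ := by gcongr; exact le_abs_self _

theorem abs_log_sub_log_le {κ : ℝ} (hκ : 0 < κ) (hx : κ ≤ x) (hy : κ ≤ y) :
    |Real.log x - Real.log y| ≤ |x - y| / κ :=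
  abs_sub_le_iff.2 ⟨log_sub_log_le_abs_sub_div hκ hx hy,
    abs_sub_comm x y ▸ log_sub_log_le_abs_sub_div hκ hy hx⟩

end RealInequalities

section Divergence

variable {ι : Type*} {u v w x : ι → ℝ}

theorem eq_zero_of_support_subset (h : support w ⊆ support u) {i : ι} (hi : u i = 0) : w i = 0 :=
  by_contra fun hw => h hw hi

theorem pos_of_support_subset (h : support w ⊆ support u) (hu : 0 ≤ u) {i : ι} (hi : w i ≠ 0) :
    0 < u i :=
  (hu i).lt_of_ne' (h hi)

theorem isClosed_setOf_support_subset (s : Set ι) : IsClosed {w : ι → ℝ | support w ⊆ s} := by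
  simp only [Function.support_subset_iff', Set.ofPred_forall]
  exact isClosed_biInter fun i _ => isClosed_eq (continuous_apply i) continuous_const

variable [Fintype ι]

/-- The finite value of the Kullback-Leibler divergence of `w` from `u`; it agrees with `klDist`
when the support of `w` is contained in that of `u`. -/
noncomputable def klSum (w u : ι → ℝ) : ℝ := w ⬝ᵥ (Real.log ∘ (w / u))

theorem klSum_self (v : ι → ℝ) : klSum v v = 0 := by
  refine Finset.sum_eq_zero fun i _ => ?_
  by_cases hi : v i = 0 <;> simp [hi]

theorem continuous_klSum_left (u : ι → ℝ) : Continuous fun w => klSum w u := by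
  refine continuous_finsetSum _ fun i _ => ?_
  by_cases hu : u i = 0
  · simp [hu, continuous_const]
  have hterm : (fun w : ι → ℝ => w i * (Real.log ∘ (w / u)) i) =
      fun w => u i * ((w i / u i) * Real.log (w i / u i)) := by
    funext w
    simp only [Function.comp_apply, Pi.div_apply]
    field_simp
  rw [hterm]
  exact continuous_const.mul (Real.continuous_mul_log.comp (by fun_prop))

theorem tendsto_klSum_right {α : Type*} {l : Filter α} {f : α → ι → ℝ}
    (h : Tendsto f l (𝓝 x)) : Tendsto (fun a => klSum x (f a)) l (𝓝 0) := by
  rw [← klSum_self x]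
  refine tendsto_finsetSum _ fun i _ => ?_
  by_cases hi : x i = 0
  · simp [hi, tendsto_const_nhds]
  have hfi : Tendsto (fun a => f a i) l (𝓝 (x i)) := tendsto_pi_nhds.1 h i
  exact ((tendsto_const_nhds.div hfi hi).log (div_ne_zero hi hi)).const_mul _

theorem klSum_eq_klSum_add_dotProduct_log (hvw : support v ⊆ support w)
    (hwu : support w ⊆ support u) : klSum v u = klSum v w + v ⬝ᵥ (Real.log ∘ (w / u)) := by
  rw [klSum, klSum, ← dotProduct_add]
  refine Finset.sum_congr rfl fun i _ => ?_
  by_cases hv : v i = 0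
  · simp [hv]
  have hw : w i ≠ 0 := hvw hv
  have hu : u i ≠ 0 := hwu hw
  simp only [Function.comp_apply, Pi.div_apply, Pi.add_apply]
  rw [Real.log_div hv hu, Real.log_div hv hw, Real.log_div hw hu]
  ring

theorem klSum_three_point (hvw : support v ⊆ support w) (hwu : support w ⊆ support u) :
    klSum v u = klSum v w + klSum w u + (v - w) ⬝ᵥ (Real.log ∘ (w / u)) := by
  rw [klSum_eq_klSum_add_dotProduct_log hvw hwu, sub_dotProduct, klSum.eq_def w u]
  ring

theorem sum_mul_log_div_sub_add (hw : w ∈ stdSimplex ℝ ι) (hu : u ∈ stdSimplex ℝ ι) :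
    ∑ i, (w i * Real.log (w i / u i) - w i + u i) = klSum w u := by
  rw [Finset.sum_add_distrib, Finset.sum_sub_distrib, hw.2, hu.2, sub_add_cancel]
  rfl

theorem sum_sq_sub_le_four_mul_klSum (hw : w ∈ stdSimplex ℝ ι) (hu : u ∈ stdSimplex ℝ ι)
    (h : support w ⊆ support u) : ∑ i, (w i - u i) ^ 2 ≤ 4 * klSum w u := by
  rw [← sum_mul_log_div_sub_add hw hu, Finset.mul_sum]
  gcongr with i
  calc (w i - u i) ^ 2 ≤ 4 * (√(w i) - √(u i)) ^ 2 :=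
        sq_sub_le_four_mul_sq_sqrt_sub_sqrt (mem_Icc_of_mem_stdSimplex hw i)
          (mem_Icc_of_mem_stdSimplex hu i)
    _ ≤ 4 * (w i * Real.log (w i / u i) - w i + u i) := by
        gcongr
        exact sq_sqrt_sub_sqrt_le_mul_log_div (hw.1 i) (hu.1 i) fun hi => h hi

theorem klSum_nonneg (hw : w ∈ stdSimplex ℝ ι) (hu : u ∈ stdSimplex ℝ ι)
    (h : support w ⊆ support u) : 0 ≤ klSum w u := by
  have hpinsker := sum_sq_sub_le_four_mul_klSum hw hu h
  have hsq : 0 ≤ ∑ i, (w i - u i) ^ 2 := Finset.sum_nonneg fun i _ => sq_nonneg _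
  linarith

theorem dist_sq_le_four_mul_klSum (hw : w ∈ stdSimplex ℝ ι) (hu : u ∈ stdSimplex ℝ ι)
    (h : support w ⊆ support u) : dist w u ^ 2 ≤ 4 * klSum w u := by
  have hkl := klSum_nonneg hw hu h
  rw [← Real.le_sqrt dist_nonneg (by positivity)]
  refine (dist_pi_le_iff (Real.sqrt_nonneg _)).2 fun i => Real.abs_le_sqrt ?_
  exact (Finset.single_le_sum (f := fun i => (w i - u i) ^ 2) (fun j _ => sq_nonneg _)
    (Finset.mem_univ i)).trans (sum_sq_sub_le_four_mul_klSum hw hu h)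

theorem eq_of_klSum_nonpos (hw : w ∈ stdSimplex ℝ ι) (hu : u ∈ stdSimplex ℝ ι)
    (h : support w ⊆ support u) (h0 : klSum w u ≤ 0) : w = u := by
  have hdist := dist_sq_le_four_mul_klSum hw hu h
  exact dist_eq_zero.1 (pow_eq_zero_iff two_ne_zero |>.1 (le_antisymm (by linarith) (sq_nonneg _)))

theorem mul_log_div_le_klSum_add_one (hv : v ∈ stdSimplex ℝ ι) (hw : w ∈ stdSimplex ℝ ι)
    (h : support v ⊆ support w) (i : ι) : v i * Real.log (v i / w i) ≤ klSum v w + 1 := by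
  have hterm : ∀ k, 0 ≤ v k * Real.log (v k / w k) - v k + w k := fun k =>
    (sq_nonneg _).trans (sq_sqrt_sub_sqrt_le_mul_log_div (hv.1 k) (hw.1 k) fun hk => h hk)
  have hsingle := Finset.single_le_sum (f := fun k => v k * Real.log (v k / w k) - v k + w k)
    (fun k _ => hterm k) (Finset.mem_univ i)
  rw [sum_mul_log_div_sub_add hv hw] at hsingle
  linarith [(mem_Icc_of_mem_stdSimplex hv i).2, hw.1 i]

theorem exists_pos_forall_le_of_klSum_le (hv : v ∈ stdSimplex ℝ ι) (B : ℝ) :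
    ∃ κ > 0, ∀ w ∈ stdSimplex ℝ ι, support v ⊆ support w → klSum v w ≤ B →
      ∀ i, v i ≠ 0 → κ ≤ w i := by
  have hlower : ∀ w ∈ stdSimplex ℝ ι, support v ⊆ support w → klSum v w ≤ B →
      ∀ i, v i ≠ 0 → v i / Real.exp ((B + 1) / v i) ≤ w i := by
    intro w hw hvw hB i hi
    have hvi : 0 < v i := (hv.1 i).lt_of_ne' hi
    have hwi : 0 < w i := pos_of_support_subset hvw hw.1 hi
    have hlog : Real.log (v i / w i) ≤ (B + 1) / v i := by
      rw [le_div_iff₀' hvi]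
      linarith [mul_log_div_le_klSum_add_one hv hw hvw i]
    rw [div_le_comm₀ (Real.exp_pos _) hwi]
    exact (Real.log_le_iff_le_exp (by positivity)).1 hlog
  have hfin : (support v).Finite := Set.toFinite _
  obtain ⟨κ, hκ, hle⟩ : ∃ κ > 0, ∀ i ∈ support v, κ ≤ v i / Real.exp ((B + 1) / v i) := by
    rcases (support v).eq_empty_or_nonempty with hempty | hne
    · exact ⟨1, one_pos, by simp [hempty]⟩
    · obtain ⟨i, hi, hmin⟩ :=
        Set.exists_min_image _ (fun i => v i / Real.exp ((B + 1) / v i)) hfin hne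
      exact ⟨_, div_pos ((hv.1 i).lt_of_ne' hi) (Real.exp_pos _), hmin⟩
  exact ⟨κ, hκ, fun w hw hvw hB i hi => (hle i hi).trans (hlower w hw hvw hB i hi)⟩

end Divergence

section KLDomain

variable {ι : Type*} [Fintype ι] {C : Set (ι → ℝ)} {u p v : ι → ℝ} {ε : ℝ}

/-- The points of `C` in the probability simplex at finite Kullback-Leibler divergence from `u`:
the effective domain of the problem solved by the KL projection of `u` onto `C`. -/
def klDomain (C : Set (ι → ℝ)) (u : ι → ℝ) : Set (ι → ℝ) :=
  {v | v ∈ C ∧ v ∈ stdSimplex ℝ ι ∧ support v ⊆ support u}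

theorem isCompact_klDomain (hC : IsClosed C) (u : ι → ℝ) : IsCompact (klDomain C u) :=
  ((isCompact_stdSimplex ℝ ι).inter_right (isClosed_setOf_support_subset _)).inter_left hC

theorem convex_klDomain (hC : Convex ℝ C) (u : ι → ℝ) : Convex ℝ (klDomain C u) := by
  intro v hv w hw r s hr hs hrs
  refine ⟨hC hv.1 hw.1 hr hs hrs, convex_stdSimplex ℝ ι hv.2.1 hw.2.1 hr hs hrs, ?_⟩
  rw [Function.support_subset_iff']
  intro i hi
  simp [Function.notMem_support.1 fun h => hi (hv.2.2 h),
    Function.notMem_support.1 fun h => hi (hw.2.2 h)]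

theorem klDomain_subset_of_support_subset (h : support p ⊆ support u) :
    klDomain C p ⊆ klDomain C u :=
  fun _ hv => ⟨hv.1, hv.2.1, hv.2.2.trans h⟩

/-- At a minimizer `p`, Gibbs' inequality `KL(p ‖ r) ≥ 0` for a point `r` of the segment from `p`
to `v` replaces the differentiation of the divergence along the segment. -/
theorem dotProduct_log_segment_nonneg (hC : Convex ℝ C) (hp : p ∈ klDomain C u)
    (hmin : IsMinOn (klSum · u) (klDomain C u) p) (hv : v ∈ klDomain C u)
    (h0 : 0 < ε) (h1 : ε < 1) : 0 ≤ (v - p) ⬝ᵥ (Real.log ∘ ((p + ε • (v - p)) / u)) := by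
  set r : ι → ℝ := p + ε • (v - p) with hr
  have hrD : r ∈ klDomain C u :=
    (convex_klDomain hC u).add_smul_sub_mem hp hv ⟨h0.le, h1.le⟩
  have hpr : support p ⊆ support r := fun i hi => by
    have hpi : 0 < p i := (hp.2.1.1 i).lt_of_ne' hi
    have hri : r i = (1 - ε) * p i + ε * v i := by
      simp only [hr, Pi.add_apply, Pi.smul_apply, Pi.sub_apply, smul_eq_mul]
      ring
    have hεv : 0 ≤ ε * v i := mul_nonneg h0.le (hv.2.1.1 i)
    rw [Function.mem_support, hri]
    nlinarith
  have hgibbs := klSum_nonneg hp.2.1 hrD.2.1 hpr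
  have hle : klSum p u ≤ klSum r u := hmin hrD
  have hchain := klSum_eq_klSum_add_dotProduct_log hpr hrD.2.2
  have hexpand : klSum r u =
      p ⬝ᵥ (Real.log ∘ (r / u)) + ε * ((v - p) ⬝ᵥ (Real.log ∘ (r / u))) := by
    rw [klSum, ← smul_eq_mul, ← smul_dotProduct, ← add_dotProduct]
  exact nonneg_of_mul_nonneg_right (by linarith) h0

theorem sub_mul_log_segment_le {p v u ε δ : ℝ} (hp : 0 ≤ p) (hv : 0 ≤ v) (hu : 0 ≤ u)
    (h0 : 0 < ε) (h : ε ≤ δ) (h1 : δ < 1) :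
    (v - p) * Real.log ((p + ε * (v - p)) / u) ≤ (v - p) * Real.log ((p + δ * (v - p)) / u) := by
  rcases hu.eq_or_lt with rfl | hu
  · simp
  rcases lt_trichotomy v p with hvp | rfl | hvp
  · have hpos : 0 < p + δ * (v - p) := by nlinarith
    have hle : p + δ * (v - p) ≤ p + ε * (v - p) := by nlinarith
    exact mul_le_mul_of_nonpos_left (Real.log_le_log (div_pos hpos hu) (by gcongr)) (by linarith)
  · simp
  · have hpos : 0 < p + ε * (v - p) := by nlinarith
    have hle : p + ε * (v - p) ≤ p + δ * (v - p) := by nlinarith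
    exact mul_le_mul_of_nonneg_left (Real.log_le_log (div_pos hpos hu) (by gcongr)) (by linarith)

theorem tendsto_log_mul_nhdsGT_zero {c : ℝ} (hc : 0 < c) :
    Tendsto (fun ε : ℝ => Real.log (ε * c)) (𝓝[>] 0) atBot := by
  refine Real.tendsto_log_nhdsGT_zero.comp (tendsto_nhdsWithin_iff.2 ⟨?_, ?_⟩)
  · exact (Continuous.tendsto' (by fun_prop) 0 0 (zero_mul c)).mono_left nhdsWithin_le_nhds
  · filter_upwards [self_mem_nhdsWithin] with ε hε using mul_pos (Set.mem_Ioi.1 hε) hc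

/-- If `p k = 0 < v k`, then the directional derivative of the divergence at `p` towards `v` is
`-∞`: the `k`-th term tends to `-∞` and the others are bounded above by their values at
`ε = 1 / 2`. -/
theorem support_subset_of_isMinOn_klSum (hC : Convex ℝ C) (hu : 0 ≤ u) (hp : p ∈ klDomain C u)
    (hmin : IsMinOn (klSum · u) (klDomain C u) p) (hv : v ∈ klDomain C u) :
    support v ⊆ support p := by
  classical
  intro k hvk
  by_contra hpk
  rw [Function.notMem_support] at hpk
  have hvk0 : 0 < v k := (hv.2.1.1 k).lt_of_ne' hvk
  have huk : 0 < u k := pos_of_support_subset hv.2.2 hu hvk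
  set M : ℝ := ∑ i ∈ Finset.univ.erase k, (v i - p i) * Real.log ((p i + 1 / 2 * (v i - p i)) / u i)
  have hbound : ∀ᶠ ε : ℝ in 𝓝[>] 0, 0 ≤ v k * Real.log (ε * (v k / u k)) + M := by
    filter_upwards [Ioc_mem_nhdsGT (show (0 : ℝ) < 1 / 2 by norm_num)] with ε hε
    refine (dotProduct_log_segment_nonneg hC hp hmin hv hε.1 (by linarith [hε.2])).trans ?_
    rw [dotProduct, ← Finset.add_sum_erase _ _ (Finset.mem_univ k)]
    refine add_le_add (le_of_eq ?_) (Finset.sum_le_sum fun i _ =>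
      sub_mul_log_segment_le (hp.2.1.1 i) (hv.2.1.1 i) (hu i) hε.1 hε.2 (by norm_num))
    simp [hpk, mul_div_assoc]
  have hlim : Tendsto (fun ε : ℝ => v k * Real.log (ε * (v k / u k)) + M) (𝓝[>] 0) atBot :=
    tendsto_atBot_add_const_right _ _
      (Tendsto.const_mul_atBot hvk0 (tendsto_log_mul_nhdsGT_zero (div_pos hvk0 huk)))
  obtain ⟨ε, hnonneg, hneg⟩ := (hbound.and (hlim.eventually_lt_atBot 0)).exists
  exact hneg.not_ge hnonneg

theorem dotProduct_log_nonneg_of_isMinOn_klSum (hC : Convex ℝ C) (hp : p ∈ klDomain C u)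
    (hmin : IsMinOn (klSum · u) (klDomain C u) p) (hv : v ∈ klDomain C u)
    (hvp : support v ⊆ support p) : 0 ≤ (v - p) ⬝ᵥ (Real.log ∘ (p / u)) := by
  have hlim : Tendsto (fun ε : ℝ => (v - p) ⬝ᵥ (Real.log ∘ ((p + ε • (v - p)) / u)))
      (𝓝[>] 0) (𝓝 ((v - p) ⬝ᵥ (Real.log ∘ (p / u)))) := by
    refine tendsto_finsetSum _ fun i _ => ?_
    by_cases hpi : p i = 0
    · simp [hpi, eq_zero_of_support_subset hvp hpi]
    have hui : u i ≠ 0 := hp.2.2 hpi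
    have hcont : ContinuousAt
        (fun ε : ℝ => (v i - p i) * Real.log ((p i + ε * (v i - p i)) / u i)) 0 :=
      continuousAt_const.mul (ContinuousAt.log (by fun_prop) (by simp [hpi, hui]))
    simpa using hcont.tendsto.mono_left nhdsWithin_le_nhds
  refine ge_of_tendsto hlim ?_
  filter_upwards [Ioo_mem_nhdsGT (zero_lt_one (α := ℝ))] with ε hε
  exact dotProduct_log_segment_nonneg hC hp hmin hv hε.1 hε.2

end KLDomain

section NormalCone

variable {ι : Type*} [Fintype ι] {C : Set (ι → ℝ)} {p s v : ι → ℝ}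

/-- `s` is an outer normal at `p` to the set of the points of `C` in the face of the probability
simplex spanned by the support of `p`. Only this face is seen by the logarithms of the correction
terms, which are undefined off the support of `p`. -/
def IsNormalAt (C : Set (ι → ℝ)) (p s : ι → ℝ) : Prop :=
  ∀ v ∈ klDomain C p, (v - p) ⬝ᵥ s ≤ 0

theorem IsNormalAt.congr_add_const {s' : ι → ℝ} {c : ℝ} (h : IsNormalAt C p s)
    (hp : p ∈ stdSimplex ℝ ι) (hs : ∀ i, p i ≠ 0 → s' i = s i + c) : IsNormalAt C p s' := by
  intro v hv
  have hsum : ∑ i, (v i - p i) = 0 := by rw [Finset.sum_sub_distrib, hv.2.1.2, hp.2, sub_self]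
  calc (v - p) ⬝ᵥ s' = ∑ i, ((v i - p i) * s i + (v i - p i) * c) := by
        refine Finset.sum_congr rfl fun i _ => ?_
        by_cases hi : p i = 0
        · simp [hi, eq_zero_of_support_subset hv.2.2 hi]
        · rw [hs i hi, mul_add]; rfl
    _ = (v - p) ⬝ᵥ s := by
        rw [Finset.sum_add_distrib, ← Finset.sum_mul, hsum, zero_mul, add_zero]
        rfl
    _ ≤ 0 := h v hv

theorem eventually_nonneg_sub_smul_sub {ι : Type*} [Finite ι] {p v : ι → ℝ} (hp : 0 ≤ p)
    (hvp : support v ⊆ support p) :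
    ∀ᶠ ε : ℝ in 𝓝[>] 0, 0 ≤ p - ε • (v - p) := by
  refine eventually_all.2 fun i => ?_
  rcases (hp i).eq_or_lt with hi | hi
  · exact Eventually.of_forall fun ε => by simp [eq_zero_of_support_subset hvp hi.symm, ← hi]
  · have hcont : Continuous fun ε : ℝ => (p - ε • (v - p)) i := by
      simp only [Pi.sub_apply, Pi.smul_apply]
      fun_prop
    have hlim := hcont.tendsto' 0 (p i) (by simp)
    exact ((hlim.mono_left nhdsWithin_le_nhds).eventually (lt_mem_nhds hi)).mono fun _ => le_of_lt

theorem IsNormalAt.dotProduct_nonneg (h : IsNormalAt C p s) (hp : p ∈ stdSimplex ℝ ι)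
    (hv : v ∈ stdSimplex ℝ ι) (hvp : support v ⊆ support p)
    (hC : ∀ᶠ ε : ℝ in 𝓝[>] 0, p - ε • (v - p) ∈ C) : 0 ≤ (v - p) ⬝ᵥ s := by
  obtain ⟨ε, ⟨hεC, hnonneg⟩, hε⟩ :=
    ((hC.and (eventually_nonneg_sub_smul_sub hp.1 hvp)).and self_mem_nhdsWithin).exists
  have hsum : ∑ i, (p - ε • (v - p)) i = 1 := by
    simp [Finset.sum_sub_distrib, ← Finset.mul_sum, hp.2, hv.2]
  have hsupp : support (p - ε • (v - p)) ⊆ support p := by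
    rw [Function.support_subset_iff']
    intro i hi
    rw [Function.notMem_support] at hi
    simp [hi, eq_zero_of_support_subset hvp hi]
  have hle := h _ ⟨hεC, ⟨hnonneg, hsum⟩, hsupp⟩
  rw [sub_sub_cancel_left, neg_dotProduct, smul_dotProduct, smul_eq_mul, neg_nonpos] at hle
  exact nonneg_of_mul_nonneg_right hle (Set.mem_Ioi.1 hε)

end NormalCone

section Projection

variable {N : ℕ} {C : Set (Fin N → ℝ)} {u p v w : Fin N → ℝ}

theorem klDist_of_support_subset (h : support w ⊆ support u) : klDist w u = klSum w u :=
  if_pos fun _ hi => eq_zero_of_support_subset h hi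

theorem klDist_ne_top_iff : klDist w u ≠ ⊤ ↔ support w ⊆ support u := by
  refine ⟨fun h i hw hu => h (if_neg fun hall => hw (hall i hu)), fun h => ?_⟩
  rw [klDist_of_support_subset h]
  exact EReal.coe_ne_top _

theorem isKLProj_iff :
    IsKLProj C u p ↔ p ∈ klDomain C u ∧ IsMinOn (klSum · u) (klDomain C u) p := by
  have hcoe : ∀ {w}, support p ⊆ support u → support w ⊆ support u →
      (klDist p u ≤ klDist w u ↔ klSum p u ≤ klSum w u) := fun hp hw => by
    rw [klDist_of_support_subset hp, klDist_of_support_subset hw, EReal.coe_le_coe_iff]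
  constructor
  · rintro ⟨⟨hpC, hpΔ⟩, hfin, hmin⟩
    have hpu := klDist_ne_top_iff.1 hfin
    exact ⟨⟨hpC, hpΔ, hpu⟩, fun w hw => (hcoe hpu hw.2.2).1 (hmin w ⟨hw.1, hw.2.1⟩)⟩
  · rintro ⟨⟨hpC, hpΔ, hpu⟩, hmin⟩
    refine ⟨⟨hpC, hpΔ⟩, klDist_ne_top_iff.2 hpu, fun w hw => ?_⟩
    by_cases hwu : support w ⊆ support u
    · exact (hcoe hpu hwu).2 (hmin ⟨hw.1, hw.2, hwu⟩)
    · rw [not_not.1 (klDist_ne_top_iff.not.2 hwu)]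
      exact le_top

theorem IsKLProj.mem_klDomain (h : IsKLProj C u p) : p ∈ klDomain C u := (isKLProj_iff.1 h).1

theorem exists_isKLProj (hC : IsClosed C) (hne : (klDomain C u).Nonempty) :
    ∃ p, IsKLProj C u p := by
  obtain ⟨p, hp, hmin⟩ :=
    (isCompact_klDomain hC u).exists_isMinOn hne (continuous_klSum_left u).continuousOn
  exact ⟨p, isKLProj_iff.2 ⟨hp, hmin⟩⟩

theorem IsKLProj.klDomain_eq (h : IsKLProj C u p) (hC : Convex ℝ C) (hu : 0 ≤ u) :
    klDomain C p = klDomain C u := by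
  obtain ⟨hp, hmin⟩ := isKLProj_iff.1 h
  exact (klDomain_subset_of_support_subset hp.2.2).antisymm fun v hv =>
    ⟨hv.1, hv.2.1, support_subset_of_isMinOn_klSum hC hu hp hmin hv⟩

theorem IsKLProj.support_subset (h : IsKLProj C u p) (hC : Convex ℝ C) (hu : 0 ≤ u)
    (hv : v ∈ klDomain C u) : support v ⊆ support p :=
  ((h.klDomain_eq hC hu).ge hv).2.2

theorem IsKLProj.isNormalAt (h : IsKLProj C u p) (hC : Convex ℝ C) :
    IsNormalAt C p (-(Real.log ∘ (p / u))) := by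
  intro v hv
  obtain ⟨hp, hmin⟩ := isKLProj_iff.1 h
  rw [dotProduct_neg, neg_nonpos]
  exact dotProduct_log_nonneg_of_isMinOn_klSum hC hp hmin
    (klDomain_subset_of_support_subset hp.2.2 hv) hv.2.2

theorem klSum_add_klSum_le_of_isNormalAt (hpu : support p ⊆ support u)
    (hn : IsNormalAt C p (-(Real.log ∘ (p / u)))) (hv : v ∈ klDomain C p) :
    klSum v p + klSum p u ≤ klSum v u := by
  have hle := hn v hv
  rw [dotProduct_neg, neg_nonpos] at hle
  rw [klSum_three_point hv.2.2 hpu]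
  exact le_add_of_nonneg_right hle

theorem isKLProj_of_isNormalAt (hp : p ∈ klDomain C u) (hup : support u ⊆ support p)
    (hn : IsNormalAt C p (-(Real.log ∘ (p / u)))) : IsKLProj C u p := by
  refine isKLProj_iff.2 ⟨hp, fun v hv => ?_⟩
  have hvp : v ∈ klDomain C p := klDomain_subset_of_support_subset hup hv
  exact (le_add_of_nonneg_left (klSum_nonneg hvp.2.1 hp.2.1 hvp.2.2)).trans
    (klSum_add_klSum_le_of_isNormalAt hp.2.2 hn hvp)

theorem IsKLProj.eq (hp : IsKLProj C u p) (hv : IsKLProj C u v) (hC : Convex ℝ C) (hu : 0 ≤ u) :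
    v = p := by
  have hvp : v ∈ klDomain C p := hp.klDomain_eq hC hu ▸ hv.mem_klDomain
  have hpyth := klSum_add_klSum_le_of_isNormalAt hp.mem_klDomain.2.2 (hp.isNormalAt hC) hvp
  have hle : klSum v u ≤ klSum p u := (isKLProj_iff.1 hv).2 hp.mem_klDomain
  exact eq_of_klSum_nonpos hvp.2.1 hp.mem_klDomain.2.1 hvp.2.2 (by linarith)

theorem existsUnique_isKLProj (hcl : IsClosed C) (hC : Convex ℝ C) (hu : 0 ≤ u)
    (hne : (klDomain C u).Nonempty) : ∃! p, IsKLProj C u p := by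
  obtain ⟨p, hp⟩ := exists_isKLProj hcl hne
  exact ⟨p, hp, fun v hv => hp.eq hv hC hu⟩

theorem IsKLProj.klSum_eq (h : IsKLProj C u p) (hC : Convex ℝ C) (hv : v ∈ klDomain C p)
    (hext : ∀ᶠ ε : ℝ in 𝓝[>] 0, p - ε • (v - p) ∈ C) :
    klSum v u = klSum v p + klSum p u := by
  have hpu := h.mem_klDomain.2.2
  have hn := h.isNormalAt hC
  have hge := hn.dotProduct_nonneg h.1.2 hv.2.1 hv.2.2 hext
  rw [dotProduct_neg, neg_nonneg] at hge
  refine le_antisymm ?_ (klSum_add_klSum_le_of_isNormalAt hpu hn hv)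
  rw [klSum_three_point hv.2.2 hpu]
  exact add_le_of_nonpos_right hge

end Projection

section LinearConstraints

variable {N : ℕ} {a : Fin N → ℝ} {τ : ℝ} {p v : Fin N → ℝ}

theorem convex_linHyperplane (a : Fin N → ℝ) (τ : ℝ) : Convex ℝ (linHyperplane a τ) :=
  convex_hyperplane (dotProductBilin ℝ ℝ a).isLinear τ

theorem isClosed_linHyperplane (a : Fin N → ℝ) (τ : ℝ) : IsClosed (linHyperplane a τ) :=
  isClosed_eq (continuous_const.dotProduct continuous_id) continuous_const

theorem sub_smul_sub_mem_linHyperplane (hp : p ∈ linHyperplane a τ) (hv : v ∈ linHyperplane a τ)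
    (ε : ℝ) : p - ε • (v - p) ∈ linHyperplane a τ := by
  simp only [linHyperplane, Set.mem_ofPred_eq] at hp hv ⊢
  rw [dotProduct_sub, dotProduct_smul, dotProduct_sub, hp, hv, sub_self, smul_zero, sub_zero]

theorem setOf_mulVec_eq_iInter_linHyperplane {K : ℕ} (X : Matrix (Fin N) (Fin K) ℝ)
    (t : Fin K → ℝ) :
    {v | X.transpose.mulVec v = t} = ⋂ k, linHyperplane (fun i => X i k) (t k) := by
  ext v
  rw [Set.mem_iInter]
  exact funext_iff

/-- Near each of its points, `C` is a cone: if `p ∈ C` is close to `x ∈ C`, then the segment from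
`x` to `p` can be prolonged beyond `p` within `C`. Intersections of finitely many closed half-spaces
have this property, and it is all that the convergence proof for polyhedral sets needs. -/
def IsLocallyConical {E : Type*} [AddCommGroup E] [Module ℝ E] [TopologicalSpace E]
    (C : Set E) : Prop :=
  ∀ x ∈ C, ∀ᶠ p in 𝓝[C] x, ∀ᶠ ε : ℝ in 𝓝[>] 0, p - ε • (x - p) ∈ C

theorem isLocallyConical_linHyperplane (a : Fin N → ℝ) (τ : ℝ) :
    IsLocallyConical (linHyperplane a τ) := by
  intro x hx
  filter_upwards [self_mem_nhdsWithin] with p hp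
  exact Eventually.of_forall (sub_smul_sub_mem_linHyperplane hp hx)

theorem isLocallyConical_linHalfspace (a : Fin N → ℝ) (τ : ℝ) :
    IsLocallyConical (linHalfspace a τ) := by
  intro x hx
  have hcont : Continuous fun p => a ⬝ᵥ p := continuous_const.dotProduct continuous_id
  rcases (show a ⬝ᵥ x ≤ τ from hx).eq_or_lt with htight | hslack
  · filter_upwards [self_mem_nhdsWithin] with p (hp : a ⬝ᵥ p ≤ τ)
    filter_upwards [self_mem_nhdsWithin] with ε (hε : 0 < ε)
    have hmul : 0 ≤ ε * (τ - a ⬝ᵥ p) := mul_nonneg hε.le (sub_nonneg.2 hp)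
    simp only [linHalfspace, Set.mem_ofPred_eq, dotProduct_sub, dotProduct_smul, smul_eq_mul,
      htight]
    linarith
  · filter_upwards [nhdsWithin_le_nhds (hcont.continuousAt.eventually (gt_mem_nhds hslack))]
      with p (hp : a ⬝ᵥ p < τ)
    have hlim : Tendsto (fun ε : ℝ => a ⬝ᵥ (p - ε • (x - p))) (𝓝 0) (𝓝 (a ⬝ᵥ p)) :=
      (hcont.comp (by fun_prop : Continuous fun ε : ℝ => p - ε • (x - p))).tendsto' 0 _ (by simp)
    exact nhdsWithin_le_nhds ((hlim.eventually (gt_mem_nhds hp)).mono fun _ => le_of_lt)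

theorem isLocallyConical_of_eq_linHyperplane_or_linHalfspace {C : Set (Fin N → ℝ)}
    (h : ∃ (a : Fin N → ℝ) (τ : ℝ), C = linHyperplane a τ ∨ C = linHalfspace a τ) :
    IsLocallyConical C := by
  obtain ⟨a, τ, rfl | rfl⟩ := h
  · exact isLocallyConical_linHyperplane a τ
  · exact isLocallyConical_linHalfspace a τ

end LinearConstraints

section Normalization

variable {N : ℕ} {u v p : Fin N → ℝ}

theorem normalizeVec_mem_stdSimplex (hv : 0 ≤ v) (hsum : 0 < ∑ i, v i) :
    normalizeVec v ∈ stdSimplex ℝ (Fin N) :=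
  ⟨fun i => div_nonneg (hv i) hsum.le, by
    simp only [normalizeVec, ← Finset.sum_div, div_self hsum.ne']⟩

theorem support_normalizeVec (hsum : ∑ i, v i ≠ 0) : support (normalizeVec v) = support v := by
  ext i
  simp [normalizeVec, hsum]

theorem sum_mul_pos_of_mem_stdSimplex {ι : Type*} [Fintype ι] {w q : ι → ℝ}
    (hw : w ∈ stdSimplex ℝ ι) (hq : ∀ i, w i ≠ 0 → 0 < q i) : 0 < ∑ i, w i * q i := by
  obtain ⟨i, hi⟩ : ∃ i, w i ≠ 0 := by
    by_contra! hzero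
    simpa [hzero] using hw.2
  refine Finset.sum_pos' (fun k _ => ?_) ⟨i, Finset.mem_univ i,
    mul_pos ((hw.1 i).lt_of_ne' hi) (hq i hi)⟩
  by_cases hk : w k = 0
  · simp [hk]
  · exact mul_nonneg (hw.1 k) (hq k hk).le

theorem log_div_normalizeVec {i : Fin N} (hp : p i ≠ 0) (hv : v i ≠ 0) (hsum : ∑ l, v l ≠ 0) :
    Real.log (p i / normalizeVec v i) = Real.log (∑ l, v l) - Real.log (v i / p i) := by
  rw [normalizeVec, ← Real.log_div hsum (div_ne_zero hv hp)]
  congr 1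
  field_simp

/-- The logarithm of the density of an exponential tilt is affine in `a`, hence normal to the
hyperplanes orthogonal to `a`. -/
theorem isKLProj_normalizeVec_tilt {a : Fin N → ℝ} {τ α : ℝ} (hu : u ∈ stdSimplex ℝ (Fin N))
    (hp : p = normalizeVec fun i => u i * Real.exp (α * a i)) (hpC : p ∈ linHyperplane a τ) :
    IsKLProj (linHyperplane a τ) u p := by
  set r : Fin N → ℝ := fun i => u i * Real.exp (α * a i) with hr
  have hsum : 0 < ∑ i, r i := sum_mul_pos_of_mem_stdSimplex hu fun i _ => Real.exp_pos _
  have hpΔ : p ∈ stdSimplex ℝ (Fin N) :=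
    hp ▸ normalizeVec_mem_stdSimplex (fun i => mul_nonneg (hu.1 i) (Real.exp_pos _).le) hsum
  have hsupp : support p = support u := by
    rw [hp, support_normalizeVec hsum.ne']
    ext i
    simp [hr]
  have horth : IsNormalAt (linHyperplane a τ) p (-(α • a)) := fun v hv => by
    have hvp : (v - p) ⬝ᵥ a = 0 := by
      rw [dotProduct_comm, dotProduct_sub, show a ⬝ᵥ v = τ from hv.1, show a ⬝ᵥ p = τ from hpC,
        sub_self]
    rw [dotProduct_neg, dotProduct_smul, hvp, smul_zero, neg_zero]
  refine isKLProj_of_isNormalAt ⟨hpC, hpΔ, hsupp.subset⟩ hsupp.symm.subset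
    (horth.congr_add_const hpΔ (c := Real.log (∑ i, r i)) fun i hi => ?_)
  have hui : u i ≠ 0 := hsupp.subset hi
  have hdiv : p i / u i = Real.exp (α * a i) / ∑ l, r l := by
    rw [hp, normalizeVec, hr]
    field_simp
  simp only [Pi.neg_apply, Function.comp_apply, Pi.div_apply, Pi.smul_apply, smul_eq_mul]
  rw [hdiv, Real.log_div (Real.exp_pos _).ne' hsum.ne', Real.log_exp]
  ring

end Normalization

section Sequences

theorem existsUnique_seq {α : Type*} (P : α → Prop) (R : ℕ → α → α → Prop) {a : α} (ha : P a)
    (hR : ∀ n x, P x → ∃! y, R n x y) (hP : ∀ n x y, P x → R n x y → P y) :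
    ∃! f : ℕ → α, f 0 = a ∧ ∀ n, R n (f n) (f (n + 1)) := by
  choose! g hg huniq using hR
  let f : ℕ → α := fun n => Nat.rec a (fun n x => g n x) n
  have hf : ∀ n, P (f n) := fun n => by
    induction n with
    | zero => exact ha
    | succ n ih => exact hP n _ _ ih (hg n _ ih)
  refine ⟨f, ⟨rfl, fun n => hg n _ (hf n)⟩, fun f' ⟨hzero, hsucc⟩ => funext fun n => ?_⟩
  induction n with
  | zero => exact hzero
  | succ n ih => exact huniq n (f n) (hf n) _ (ih ▸ hsucc n)

theorem tendsto_sum_range_add {δ : ℕ → ℝ} (hδ : Tendsto δ atTop (𝓝 0)) (L : ℕ) :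
    Tendsto (fun n => ∑ i ∈ Finset.range L, δ (n + i)) atTop (𝓝 0) := by
  simpa using tendsto_finsetSum (Finset.range L) fun i _ => hδ.comp (tendsto_add_atTop_nat i)

theorem frequently_mul_lt_of_summable {g : ℕ → ℝ} (hg : Summable g) (J : ℕ) {ε : ℝ} (hε : 0 < ε) :
    ∃ᶠ n : ℕ in atTop, (n + J : ℕ) * g n < ε := by
  intro hge
  refine Real.not_summable_one_div_natCast ((summable_nat_add_iff J).1
    ((hg.div_const ε).of_norm_bounded_eventually_nat ?_))
  filter_upwards [hge, eventually_ge_atTop 1] with n hn hn1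
  have hpos : (0 : ℝ) < (n + J : ℕ) := by
    exact_mod_cast (show 0 < n + J by lia)
  rw [Real.norm_of_nonneg (by positivity), div_le_div_iff₀ hpos hε, one_mul, mul_comm]
  exact not_lt.1 hn

/-- By Cauchy-Schwarz, the square of the product is at most a constant times `n + J` times the
`n`-th term of a summable sequence. -/
theorem frequently_sum_mul_sum_lt {δ : ℕ → ℝ} (hs : Summable fun n => δ n ^ 2) (J : ℕ) {ε : ℝ}
    (hε : 0 < ε) :
    ∃ᶠ n in atTop,
      (∑ i ∈ Finset.range J, δ (n + i)) * ∑ m ∈ Finset.range (n + J), δ m < ε := by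
  set S := ∑' n, δ n ^ 2
  have hsum : Summable fun n => S * (J * ∑ i ∈ Finset.range J, δ (n + i) ^ 2) :=
    ((summable_sum fun i _ => (summable_nat_add_iff i).2 hs).mul_left _).mul_left _
  refine (frequently_mul_lt_of_summable hsum J (pow_pos hε 2)).mono fun n hn => ?_
  have hhead : (∑ m ∈ Finset.range (n + J), δ m) ^ 2 ≤ (n + J : ℕ) * S := by
    calc (∑ m ∈ Finset.range (n + J), δ m) ^ 2
        ≤ (n + J : ℕ) * ∑ m ∈ Finset.range (n + J), δ m ^ 2 := by
          simpa using sq_sum_le_card_mul_sum_sq (s := Finset.range (n + J)) (f := δ)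
      _ ≤ (n + J : ℕ) * S := by
          gcongr
          exact hs.sum_le_tsum _ fun i _ => sq_nonneg _
  have hwindow : (∑ i ∈ Finset.range J, δ (n + i)) ^ 2 ≤
      J * ∑ i ∈ Finset.range J, δ (n + i) ^ 2 := by
    simpa using sq_sum_le_card_mul_sum_sq (s := Finset.range J) (f := fun i => δ (n + i))
  refine lt_of_pow_lt_pow_left₀ 2 hε.le ?_
  calc ((∑ i ∈ Finset.range J, δ (n + i)) * ∑ m ∈ Finset.range (n + J), δ m) ^ 2
      = (∑ i ∈ Finset.range J, δ (n + i)) ^ 2 * (∑ m ∈ Finset.range (n + J), δ m) ^ 2 :=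
        mul_pow _ _ _
    _ ≤ (J * ∑ i ∈ Finset.range J, δ (n + i) ^ 2) * ((n + J : ℕ) * S) :=
        mul_le_mul hwindow hhead (sq_nonneg _) ((sq_nonneg _).trans hwindow)
    _ = (n + J : ℕ) * (S * (J * ∑ i ∈ Finset.range J, δ (n + i) ^ 2)) := by ring
    _ < ε ^ 2 := hn

variable {E : Type*} [PseudoMetricSpace E] {w : ℕ → E}

theorem dist_le_sum_range_dist_add (w : ℕ → E) {n k l L : ℕ} (hnk : n ≤ k) (hkl : k ≤ l)
    (hl : l ≤ n + L) :
    dist (w k) (w l) ≤ ∑ i ∈ Finset.range L, dist (w (n + i)) (w (n + i + 1)) := by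
  calc dist (w k) (w l) ≤ ∑ i ∈ Finset.Ico k l, dist (w i) (w (i + 1)) :=
        dist_le_Ico_sum_dist w hkl
    _ ≤ ∑ i ∈ Finset.Ico n (n + L), dist (w i) (w (i + 1)) :=
        Finset.sum_le_sum_of_subset_of_nonneg (Finset.Ico_subset_Ico hnk hl)
          fun _ _ _ => dist_nonneg
    _ = ∑ i ∈ Finset.range L, dist (w (n + i)) (w (n + i + 1)) := by
        rw [Finset.sum_Ico_eq_sum_range, add_tsub_cancel_left]

theorem tendsto_dist_of_summable_dist_sq (h : Summable fun n => dist (w n) (w (n + 1)) ^ 2) :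
    Tendsto (fun n => dist (w n) (w (n + 1))) atTop (𝓝 0) := by
  simpa [Real.sqrt_sq dist_nonneg] using h.tendsto_atTop_zero.sqrt

theorem tendsto_comp_of_bounded_shift (hδ : Tendsto (fun n => dist (w n) (w (n + 1))) atTop (𝓝 0))
    {φ ψ : ℕ → ℕ} (hφ : Tendsto φ atTop atTop) {L : ℕ} (hφψ : ∀ k, φ k ≤ ψ k)
    (hψ : ∀ k, ψ k ≤ φ k + L) {x : E} (hx : Tendsto (w ∘ φ) atTop (𝓝 x)) :
    Tendsto (w ∘ ψ) atTop (𝓝 x) :=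
  (tendsto_iff_of_dist (squeeze_zero (fun _ => dist_nonneg)
    (fun k => dist_le_sum_range_dist_add w le_rfl (hφψ k) (hψ k))
    ((tendsto_sum_range_add hδ L).comp hφ))).1 hx

theorem mem_of_tendsto_of_cyclic {J : ℕ} [NeZero J] {C : Fin J → Set E}
    (hC : ∀ j, IsClosed (C j)) (hw : ∀ n, w (n + 1) ∈ C (Fin.ofNat J n))
    (hδ : Tendsto (fun n => dist (w n) (w (n + 1))) atTop (𝓝 0)) {φ : ℕ → ℕ}
    (hφ : Tendsto φ atTop atTop) {x : E} (hx : Tendsto (w ∘ φ) atTop (𝓝 x)) (j : Fin J) :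
    x ∈ C j := by
  set ψ : ℕ → ℕ := fun k => J * (φ k / J + 1) + j with hψ
  have hψj : ∀ k, Fin.ofNat J (ψ k) = j := fun k => Fin.ext (by simp [hψ, Nat.mod_eq_of_lt j.2])
  have hφψ : ∀ k, φ k ≤ ψ k + 1 := fun k => by
    have := Nat.lt_mul_div_succ (φ k) (Nat.pos_of_neZero J)
    lia
  have hψφ : ∀ k, ψ k + 1 ≤ φ k + 2 * J := fun k => by
    have := Nat.mul_div_le (φ k) J
    have := j.2
    simp only [hψ, mul_add]
    lia
  refine (hC j).mem_of_tendsto (tendsto_comp_of_bounded_shift hδ hφ hφψ hψφ hx)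
    (Eventually.of_forall fun k => ?_)
  simpa only [hψj, Function.comp_apply] using hw (ψ k)

end Sequences

section DualAscent

variable {ι : Type*} [Fintype ι] {J : ℕ} [NeZero J] {C : Fin J → Set (ι → ℝ)} {b x v : ι → ℝ}
  {w : ℕ → ι → ℝ} {c : ℕ → ℝ}

/-- The iterates `w` of a cyclic projection method started at `b`, together with dual values `c`:
`c n` increases at each step by at least the divergence between the consecutive iterates, and
bounds the divergence of the feasible points from `b` below, with slack at least their divergence
from `w n`. -/
structure IsDualAscent (C : Fin J → Set (ι → ℝ)) (b : ι → ℝ) (w : ℕ → ι → ℝ) (c : ℕ → ℝ) :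
    Prop where
  w_zero : w 0 = b
  mem_stdSimplex : ∀ n, w n ∈ stdSimplex ℝ ι
  mem_succ : ∀ n, w (n + 1) ∈ C (Fin.ofNat J n)
  support_succ : ∀ n, support (w (n + 1)) ⊆ support (w n)
  add_klSum_le : ∀ n, c n + klSum (w (n + 1)) (w n) ≤ c (n + 1)
  support_subset : ∀ v ∈ klDomain (⋂ j, C j) b, ∀ n, support v ⊆ support (w n)
  klSum_add_le : ∀ v ∈ klDomain (⋂ j, C j) b, ∀ n, klSum v (w n) + c n ≤ klSum v b

namespace IsDualAscent

theorem support_subset_initial (h : IsDualAscent C b w c) (n : ℕ) : support (w n) ⊆ support b := by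
  rw [← h.w_zero]
  exact antitone_nat_of_succ_le (f := fun n => support (w n)) h.support_succ (Nat.zero_le n)

theorem monotone (h : IsDualAscent C b w c) : Monotone c :=
  monotone_nat_of_le_succ fun n => by
    linarith [h.add_klSum_le n,
      klSum_nonneg (h.mem_stdSimplex (n + 1)) (h.mem_stdSimplex n) (h.support_succ n)]

theorem le_klSum (h : IsDualAscent C b w c) (hv : v ∈ klDomain (⋂ j, C j) b) (n : ℕ) :
    c n ≤ klSum v b := by
  linarith [h.klSum_add_le v hv n,
    klSum_nonneg hv.2.1 (h.mem_stdSimplex n) (h.support_subset v hv n)]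

theorem summable_dist_sq (h : IsDualAscent C b w c) (hne : (klDomain (⋂ j, C j) b).Nonempty) :
    Summable fun n => dist (w n) (w (n + 1)) ^ 2 := by
  obtain ⟨v, hv⟩ := hne
  refine summable_of_sum_range_le (c := 4 * (klSum v b - c 0)) (fun n => sq_nonneg _) fun n => ?_
  calc ∑ i ∈ Finset.range n, dist (w i) (w (i + 1)) ^ 2
      ≤ ∑ i ∈ Finset.range n, 4 * (c (i + 1) - c i) := by
        gcongr with i
        rw [dist_comm]
        refine (dist_sq_le_four_mul_klSum (h.mem_stdSimplex _) (h.mem_stdSimplex _)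
          (h.support_succ i)).trans ?_
        linarith [h.add_klSum_le i]
    _ = 4 * (c n - c 0) := by rw [← Finset.mul_sum, Finset.sum_range_sub]
    _ ≤ 4 * (klSum v b - c 0) := by
        gcongr
        exact h.le_klSum hv n

theorem exists_tendsto_subseq (h : IsDualAscent C b w c) (hC : ∀ j, IsClosed (C j))
    (hne : (klDomain (⋂ j, C j) b).Nonempty) {φ : ℕ → ℕ} (hφ : Tendsto φ atTop atTop) :
    ∃ y ∈ klDomain (⋂ j, C j) b, ∃ ψ : ℕ → ℕ, Tendsto ψ atTop atTop ∧
      Tendsto (w ∘ φ ∘ ψ) atTop (𝓝 y) := by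
  obtain ⟨y, hy, ψ, hψ, hlim⟩ := (isCompact_klDomain isClosed_univ b).tendsto_subseq
    fun k => ⟨Set.mem_univ _, h.mem_stdSimplex (φ k), h.support_subset_initial (φ k)⟩
  refine ⟨y, ⟨Set.mem_iInter.2 fun j => ?_, hy.2⟩, ψ, hψ.tendsto_atTop, hlim⟩
  exact mem_of_tendsto_of_cyclic hC h.mem_succ
    (tendsto_dist_of_summable_dist_sq (h.summable_dist_sq hne)) (hφ.comp hψ.tendsto_atTop) hlim j

theorem tendsto_of_no_gap (h : IsDualAscent C b w c) (hx : x ∈ klDomain (⋂ j, C j) b)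
    (hgap : ∀ ε > 0, ∃ n, klSum x b < c n + ε) : Tendsto w atTop (𝓝 x) := by
  rw [Metric.tendsto_atTop]
  intro ε hε
  obtain ⟨n, hn⟩ := hgap (ε ^ 2 / 4) (by positivity)
  refine ⟨n, fun m hm => ?_⟩
  rw [dist_comm]
  refine lt_of_pow_lt_pow_left₀ 2 hε.le ?_
  calc dist x (w m) ^ 2 ≤ 4 * klSum x (w m) :=
        dist_sq_le_four_mul_klSum hx.2.1 (h.mem_stdSimplex m) (h.support_subset x hx m)
    _ < ε ^ 2 := by linarith [h.klSum_add_le x hx m, h.monotone hm]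

theorem isMinOn_of_no_gap (h : IsDualAscent C b w c) (hgap : ∀ ε > 0, ∃ n, klSum x b < c n + ε) :
    IsMinOn (klSum · b) (klDomain (⋂ j, C j) b) x :=
  isMinOn_iff.2 fun v hv => le_of_forall_pos_le_add fun ε hε => by
    obtain ⟨n, hn⟩ := hgap ε hε
    linarith [h.le_klSum hv n]

end IsDualAscent

theorem exists_lt_add_of_tendsto {l : Filter ℕ} [l.NeBot] {φ : ℕ → ℕ}
    (hlim : Tendsto (w ∘ φ) l (𝓝 x))
    (hle : ∀ᶠ k in l, klSum x b ≤ klSum x (w (φ k)) + c (φ k)) {ε : ℝ} (hε : 0 < ε) :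
    ∃ n, klSum x b < c n + ε := by
  obtain ⟨k, hk, (hsmall : klSum x (w (φ k)) < ε)⟩ :=
    (hle.and ((tendsto_klSum_right hlim).eventually (gt_mem_nhds hε))).exists
  exact ⟨φ k, by linarith⟩

theorem IsDualAscent.tendsto_isKLProj {N : ℕ} {C : Fin J → Set (Fin N → ℝ)} {b x : Fin N → ℝ}
    {w : ℕ → Fin N → ℝ} (h : IsDualAscent C b w c) (hconv : ∀ j, Convex ℝ (C j))
    (hgap : ∃ y ∈ klDomain (⋂ j, C j) b, ∀ ε > 0, ∃ n, klSum y b < c n + ε)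
    (hx : IsKLProj (⋂ j, C j) b x) : Tendsto w atTop (𝓝 x) := by
  obtain ⟨y, hy, hygap⟩ := hgap
  have hb : 0 ≤ b := h.w_zero ▸ (h.mem_stdSimplex 0).1
  have hyproj : IsKLProj (⋂ j, C j) b y := isKLProj_iff.2 ⟨hy, h.isMinOn_of_no_gap hygap⟩
  rw [← hx.eq hyproj (convex_iInter hconv) hb]
  exact h.tendsto_of_no_gap hy hygap

end DualAscent

section Cyclic

variable {N K : ℕ} [NeZero K] {X : Matrix (Fin N) (Fin K) ℝ} {t : Fin K → ℝ} {b : Fin N → ℝ}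
  {w : ℕ → Fin N → ℝ}

theorem isClosed_setOf_mulVec_eq {K : ℕ} (X : Matrix (Fin N) (Fin K) ℝ) (t : Fin K → ℝ) :
    IsClosed {v | X.transpose.mulVec v = t} := by
  rw [setOf_mulVec_eq_iInter_linHyperplane]
  exact isClosed_iInter fun k => isClosed_linHyperplane _ _

theorem convex_setOf_mulVec_eq {K : ℕ} (X : Matrix (Fin N) (Fin K) ℝ) (t : Fin K → ℝ) :
    Convex ℝ {v | X.transpose.mulVec v = t} := by
  rw [setOf_mulVec_eq_iInter_linHyperplane]
  exact convex_iInter fun k => convex_linHyperplane _ _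

theorem IsCyclicKLProj.mem_stdSimplex (h : IsCyclicKLProj X t b w) (hb : b ∈ stdSimplex ℝ (Fin N)) :
    ∀ n, w n ∈ stdSimplex ℝ (Fin N)
  | 0 => h.w_zero ▸ hb
  | n + 1 => (h.w_succ n).mem_klDomain.2.1

theorem IsCyclicTilt.isCyclicKLProj (h : IsCyclicTilt X t b w) (hb : b ∈ stdSimplex ℝ (Fin N)) :
    IsCyclicKLProj X t b w := by
  have hproj : ∀ n, w n ∈ stdSimplex ℝ (Fin N) →
      IsKLProj (linHyperplane (fun i => X i (Fin.ofNat K n)) (t (Fin.ofNat K n)))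
        (w n) (w (n + 1)) := fun n hn => by
    obtain ⟨α, heq, hmem⟩ := h.w_succ n
    exact isKLProj_normalizeVec_tilt hn heq hmem
  have hmem : ∀ n, w n ∈ stdSimplex ℝ (Fin N) := fun n => by
    induction n with
    | zero => exact h.w_zero ▸ hb
    | succ n ih => exact (hproj n ih).mem_klDomain.2.1
  exact ⟨h.w_zero, fun n => hproj n (hmem n)⟩

theorem existsUnique_isCyclicKLProj (hb : b ∈ stdSimplex ℝ (Fin N))
    (hne : (klDomain {v | X.transpose.mulVec v = t} b).Nonempty) :
    ∃! w : ℕ → Fin N → ℝ, IsCyclicKLProj X t b w := by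
  obtain ⟨v, hvC, hv, hvb⟩ := hne
  rw [setOf_mulVec_eq_iInter_linHyperplane, Set.mem_iInter] at hvC
  have hiff : ∀ w, IsCyclicKLProj X t b w ↔ w 0 = b ∧ ∀ n, IsKLProj
      (linHyperplane (fun i => X i (Fin.ofNat K n)) (t (Fin.ofNat K n))) (w n) (w (n + 1)) :=
    fun w => ⟨fun h => ⟨h.1, h.2⟩, fun h => ⟨h.1, h.2⟩⟩
  simp only [hiff]
  refine existsUnique_seq (fun x => x ∈ stdSimplex ℝ (Fin N) ∧ support v ⊆ support x)
    (fun n x y => IsKLProj (linHyperplane (fun i => X i (Fin.ofNat K n)) (t (Fin.ofNat K n))) x y)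
    ⟨hb, hvb⟩ (fun n x ⟨hx, hvx⟩ => ?_) (fun n x y ⟨hx, hvx⟩ hy => ⟨hy.mem_klDomain.2.1,
      hy.support_subset (convex_linHyperplane _ _) hx.1 ⟨hvC (Fin.ofNat K n), hv, hvx⟩⟩)
  exact existsUnique_isKLProj (isClosed_linHyperplane _ _) (convex_linHyperplane _ _) hx.1
    ⟨v, hvC (Fin.ofNat K n), hv, hvx⟩

namespace IsCyclicKLProj

theorem support_subset (h : IsCyclicKLProj X t b w) (hb : b ∈ stdSimplex ℝ (Fin N))
    {v : Fin N → ℝ} (hv : v ∈ klDomain {v | X.transpose.mulVec v = t} b) (n : ℕ) :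
    support v ⊆ support (w n) := by
  obtain ⟨hvC, hvΔ, hvb⟩ := hv
  rw [setOf_mulVec_eq_iInter_linHyperplane, Set.mem_iInter] at hvC
  induction n with
  | zero => exact h.w_zero ▸ hvb
  | succ n ih =>
    exact (h.w_succ n).support_subset (convex_linHyperplane _ _) (h.mem_stdSimplex hb n).1
      ⟨hvC (Fin.ofNat K n), hvΔ, ih⟩

theorem klSum_add_sum_eq (h : IsCyclicKLProj X t b w) (hb : b ∈ stdSimplex ℝ (Fin N))
    {v : Fin N → ℝ} (hv : v ∈ klDomain {v | X.transpose.mulVec v = t} b) (n : ℕ) :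
    klSum v (w n) + ∑ m ∈ Finset.range n, klSum (w (m + 1)) (w m) = klSum v b := by
  have hvC := hv.1
  rw [setOf_mulVec_eq_iInter_linHyperplane, Set.mem_iInter] at hvC
  induction n with
  | zero => simp [h.w_zero]
  | succ n ih =>
    have hpyth := (h.w_succ n).klSum_eq (convex_linHyperplane _ _)
      ⟨hvC (Fin.ofNat K n), hv.2.1, h.support_subset hb hv (n + 1)⟩
      (Eventually.of_forall fun ε => sub_smul_sub_mem_linHyperplane
        (h.w_succ n).mem_klDomain.1 (hvC (Fin.ofNat K n)) ε)
    rw [Finset.sum_range_succ]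
    linarith

theorem isDualAscent (h : IsCyclicKLProj X t b w) (hb : b ∈ stdSimplex ℝ (Fin N)) :
    IsDualAscent (fun k => linHyperplane (fun i => X i k) (t k)) b w
      fun n => ∑ m ∈ Finset.range n, klSum (w (m + 1)) (w m) where
  w_zero := h.w_zero
  mem_stdSimplex := h.mem_stdSimplex hb
  mem_succ n := (h.w_succ n).mem_klDomain.1
  support_succ n := (h.w_succ n).mem_klDomain.2.2
  add_klSum_le n := (Finset.sum_range_succ _ n).ge
  support_subset _ hv :=
    h.support_subset hb (setOf_mulVec_eq_iInter_linHyperplane X t ▸ hv)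
  klSum_add_le _ hv n :=
    (h.klSum_add_sum_eq hb (setOf_mulVec_eq_iInter_linHyperplane X t ▸ hv) n).le

theorem tendsto (h : IsCyclicKLProj X t b w) (hb : b ∈ stdSimplex ℝ (Fin N)) {x : Fin N → ℝ}
    (hx : IsKLProj {v | X.transpose.mulVec v = t} b x) : Tendsto w atTop (𝓝 x) := by
  have hascent := h.isDualAscent hb
  rw [setOf_mulVec_eq_iInter_linHyperplane] at hx
  obtain ⟨y, hy, ψ, -, hlim⟩ := hascent.exists_tendsto_subseq
    (fun k => isClosed_linHyperplane _ _) ⟨x, hx.mem_klDomain⟩ tendsto_id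
  have hyb : y ∈ klDomain {v | X.transpose.mulVec v = t} b :=
    setOf_mulVec_eq_iInter_linHyperplane X t ▸ hy
  refine hascent.tendsto_isKLProj (fun k => convex_linHyperplane _ _) ⟨y, hy, fun ε hε => ?_⟩ hx
  exact exists_lt_add_of_tendsto hlim
    (Eventually.of_forall fun k => (h.klSum_add_sum_eq hb hyb (ψ k)).ge) hε

end IsCyclicKLProj

end Cyclic

section DykstraCorrection

variable {ι : Type*} [Fintype ι]

/-- The data kept by Dykstra's method for one set `C`: the last projection `p` onto `C` and a
correction `q` whose logarithm is normal to `C` at `p`, while `w`, the current iterate, has no more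
nonzero entries than `p`. -/
structure IsDykstraCorrection (C : Set (ι → ℝ)) (w q p : ι → ℝ) : Prop where
  mem_stdSimplex : p ∈ stdSimplex ℝ ι
  support_subset : support w ⊆ support p
  pos : ∀ i, p i ≠ 0 → 0 < q i
  isNormalAt : IsNormalAt C p (Real.log ∘ q)

namespace IsDykstraCorrection

section

variable {C : Set (ι → ℝ)} {w q p z : ι → ℝ}

theorem one (C : Set (ι → ℝ)) (hw : w ∈ stdSimplex ℝ ι) :
    IsDykstraCorrection C w 1 w where
  mem_stdSimplex := hw
  support_subset := subset_rfl
  pos _ _ := one_pos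
  isNormalAt v _ := by simp [dotProduct]

theorem mono (h : IsDykstraCorrection C w q p) (hzw : support z ⊆ support w) :
    IsDykstraCorrection C z q p :=
  { h with support_subset := hzw.trans h.support_subset }

theorem pos_of_ne_zero (h : IsDykstraCorrection C w q p) {i : ι} (hi : w i ≠ 0) : 0 < q i :=
  h.pos i (h.support_subset hi)

theorem dotProduct_log_mul_div (h : IsDykstraCorrection C w q p) (hzw : support z ⊆ support w) :
    z ⬝ᵥ (Real.log ∘ (w * q / z)) = z ⬝ᵥ (Real.log ∘ q) - klSum z w := by
  simp only [klSum, dotProduct, ← Finset.sum_sub_distrib]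
  refine Finset.sum_congr rfl fun i _ => ?_
  rcases eq_or_ne (z i) 0 with hi | hi
  · simp [hi]
  have hwi : w i ≠ 0 := hzw hi
  have hq : q i ≠ 0 := (h.pos_of_ne_zero hwi).ne'
  simp only [Function.comp_apply, Pi.div_apply, Pi.mul_apply]
  rw [Real.log_div (mul_ne_zero hwi hq) hi, Real.log_mul hwi hq, Real.log_div hi hwi]
  ring

end

variable {N : ℕ} {C : Set (Fin N → ℝ)} {w q p z : Fin N → ℝ}

theorem sum_mul_pos (h : IsDykstraCorrection C w q p) (hw : w ∈ stdSimplex ℝ (Fin N)) :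
    0 < ∑ i, (w * q) i :=
  sum_mul_pos_of_mem_stdSimplex hw fun _ => h.pos_of_ne_zero

theorem support_normalizeVec_mul (h : IsDykstraCorrection C w q p)
    (hw : w ∈ stdSimplex ℝ (Fin N)) : support (normalizeVec (w * q)) = support w := by
  rw [support_normalizeVec (h.sum_mul_pos hw).ne', Function.support_mul']
  exact Set.inter_eq_left.2 fun i hi => (h.pos_of_ne_zero hi).ne'

theorem normalizeVec_mul_mem_stdSimplex (h : IsDykstraCorrection C w q p)
    (hw : w ∈ stdSimplex ℝ (Fin N)) : normalizeVec (w * q) ∈ stdSimplex ℝ (Fin N) := by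
  refine normalizeVec_mem_stdSimplex (fun i => ?_) (h.sum_mul_pos hw)
  rcases eq_or_ne (w i) 0 with hi | hi
  · simp [hi]
  · exact mul_nonneg (hw.1 i) (h.pos_of_ne_zero hi).le

theorem support_subset_of_isKLProj (h : IsDykstraCorrection C w q p)
    (hw : w ∈ stdSimplex ℝ (Fin N)) (hz : IsKLProj C (normalizeVec (w * q)) z) :
    support z ⊆ support w :=
  h.support_normalizeVec_mul hw ▸ hz.mem_klDomain.2.2

theorem of_isKLProj (h : IsDykstraCorrection C w q p) (hw : w ∈ stdSimplex ℝ (Fin N))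
    (hC : Convex ℝ C) (hz : IsKLProj C (normalizeVec (w * q)) z) :
    IsDykstraCorrection C z (w * q / z) z where
  mem_stdSimplex := hz.mem_klDomain.2.1
  support_subset := subset_rfl
  pos i hi := by
    have hwi := h.support_subset_of_isKLProj hw hz hi
    exact div_pos (mul_pos ((hw.1 i).lt_of_ne' hwi) (h.pos_of_ne_zero hwi))
      ((hz.mem_klDomain.2.1.1 i).lt_of_ne' hi)
  isNormalAt := by
    refine (hz.isNormalAt hC).congr_add_const (c := Real.log (∑ i, (w * q) i))
      hz.mem_klDomain.2.1 fun i hi => ?_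
    have hwi := h.support_subset_of_isKLProj hw hz hi
    have hwq : (w * q) i ≠ 0 := mul_ne_zero hwi (h.pos_of_ne_zero hwi).ne'
    have hlog := log_div_normalizeVec hi hwq (h.sum_mul_pos hw).ne'
    simp only [Pi.neg_apply, Function.comp_apply, Pi.div_apply, hlog]
    ring

end IsDykstraCorrection

end DykstraCorrection

section DualValue

variable {ι : Type*} [Fintype ι] {J : ℕ}

/-- Minus the sum of the support functions of the sets at the multipliers `log ∘ q j`, each attained
at `p j`: the value of the dual problem in Dykstra's method. -/
noncomputable def dualValue (q p : Fin J → ι → ℝ) : ℝ :=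
  -∑ j, p j ⬝ᵥ (Real.log ∘ q j)

theorem dualValue_one (p : Fin J → ι → ℝ) : dualValue (fun _ _ => 1) p = 0 := by
  simp [dualValue, dotProduct]

theorem dualValue_update (q p : Fin J → ι → ℝ) (j : Fin J) (s z : ι → ℝ) :
    dualValue (Function.update q j s) (Function.update p j z) =
      dualValue q p + p j ⬝ᵥ (Real.log ∘ q j) - z ⬝ᵥ (Real.log ∘ s) := by
  have hrest : ∑ k ∈ Finset.univ.erase j,
      Function.update p j z k ⬝ᵥ (Real.log ∘ Function.update q j s k) =
        ∑ k ∈ Finset.univ.erase j, p k ⬝ᵥ (Real.log ∘ q k) :=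
    Finset.sum_congr rfl fun k hk => by
      rw [Function.update_of_ne (Finset.ne_of_mem_erase hk),
        Function.update_of_ne (Finset.ne_of_mem_erase hk)]
  simp only [dualValue]
  rw [← Finset.add_sum_erase _ _ (Finset.mem_univ j),
    ← Finset.add_sum_erase _ _ (Finset.mem_univ j),
    hrest, Function.update_self, Function.update_self]
  ring

end DualValue

section DykstraInvariant

variable {ι : Type*} [Fintype ι] {N J : ℕ}

/-- The invariants of the Bregman-Dykstra scheme with iterate `w`, corrections `q` and last
projections `p` onto the individual sets. -/
structure DykstraInvariant (C : Fin J → Set (ι → ℝ)) (b w : ι → ℝ) (q p : Fin J → ι → ℝ) :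
    Prop where
  mem_stdSimplex : w ∈ stdSimplex ℝ ι
  correction : ∀ j, IsDykstraCorrection (C j) w (q j) (p j)
  support_subset : ∀ v ∈ klDomain (⋂ j, C j) b, support v ⊆ support w
  mul_prod_eq : ∀ i, w i ≠ 0 → w i * ∏ j, q j i = b i

namespace DykstraInvariant

section

variable {C : Fin J → Set (ι → ℝ)} {b w v : ι → ℝ} {q p : Fin J → ι → ℝ}

theorem initial (C : Fin J → Set (ι → ℝ)) (hb : b ∈ stdSimplex ℝ ι) :
    DykstraInvariant C b b (fun _ _ => 1) fun _ => b where
  mem_stdSimplex := hb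
  correction _ := .one _ hb
  support_subset _ hv := hv.2.2
  mul_prod_eq := by simp

theorem support_subset_initial (h : DykstraInvariant C b w q p) : support w ⊆ support b := by
  intro i hi
  rw [Function.mem_support, ← h.mul_prod_eq i hi]
  exact mul_ne_zero hi (Finset.prod_pos fun j _ => (h.correction j).pos_of_ne_zero hi).ne'

theorem log_div_eq (h : DykstraInvariant C b w q p) {i : ι} (hi : w i ≠ 0) :
    Real.log (w i / b i) = -∑ j, Real.log (q j i) := by
  rw [← h.mul_prod_eq i hi, div_mul_cancel_left₀ hi, Real.log_inv,
    Real.log_prod fun j _ => ((h.correction j).pos_of_ne_zero hi).ne']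

theorem klSum_eq (h : DykstraInvariant C b w q p) (hvw : support v ⊆ support w) :
    klSum v b = klSum v w + dualValue q p + ∑ j, (p j - v) ⬝ᵥ (Real.log ∘ q j) := by
  have hlog : v ⬝ᵥ (Real.log ∘ (w / b)) = -∑ j, v ⬝ᵥ (Real.log ∘ q j) := by
    simp only [dotProduct]
    rw [Finset.sum_comm, ← Finset.sum_neg_distrib]
    refine Finset.sum_congr rfl fun i _ => ?_
    rcases eq_or_ne (v i) 0 with hi | hi
    · simp [hi]
    · simp [h.log_div_eq (hvw hi), Finset.mul_sum]
  rw [klSum_eq_klSum_add_dotProduct_log hvw h.support_subset_initial, hlog, dualValue]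
  simp only [sub_dotProduct, Finset.sum_sub_distrib]
  ring

theorem klSum_add_dualValue_le (h : DykstraInvariant C b w q p)
    (hv : v ∈ klDomain (⋂ j, C j) b) : klSum v w + dualValue q p ≤ klSum v b := by
  have hvw := h.support_subset v hv
  rw [h.klSum_eq hvw, le_add_iff_nonneg_right]
  refine Finset.sum_nonneg fun j _ => ?_
  have hnormal := (h.correction j).isNormalAt v
    ⟨Set.mem_iInter.1 hv.1 j, hv.2.1, hvw.trans (h.correction j).support_subset⟩
  simp only [sub_dotProduct] at hnormal ⊢
  linarith

end

variable {C : Fin J → Set (Fin N → ℝ)} {b w v z : Fin N → ℝ} {q p : Fin J → Fin N → ℝ}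
  {j : Fin J}

theorem mem_klDomain_normalizeVec (h : DykstraInvariant C b w q p)
    (hv : v ∈ klDomain (⋂ j, C j) b) (j : Fin J) :
    v ∈ klDomain (C j) (normalizeVec (w * q j)) :=
  ⟨Set.mem_iInter.1 hv.1 j, hv.2.1,
    (h.correction j).support_normalizeVec_mul h.mem_stdSimplex ▸ h.support_subset v hv⟩

theorem support_subset_of_isKLProj (h : DykstraInvariant C b w q p)
    (hz : IsKLProj (C j) (normalizeVec (w * q j)) z) : support z ⊆ support w :=
  (h.correction j).support_subset_of_isKLProj h.mem_stdSimplex hz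

theorem step (h : DykstraInvariant C b w q p) (hC : Convex ℝ (C j))
    (hz : IsKLProj (C j) (normalizeVec (w * q j)) z) :
    DykstraInvariant C b z (Function.update q j (w * q j / z)) (Function.update p j z) where
  mem_stdSimplex := hz.mem_klDomain.2.1
  correction k := by
    rcases eq_or_ne k j with rfl | hk
    · simpa using (h.correction k).of_isKLProj h.mem_stdSimplex hC hz
    · simpa [hk] using (h.correction k).mono (h.support_subset_of_isKLProj hz)
  support_subset v hv := hz.support_subset hC
    ((h.correction j).normalizeVec_mul_mem_stdSimplex h.mem_stdSimplex).1
    (h.mem_klDomain_normalizeVec hv j)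
  mul_prod_eq i hi := by
    have hrest : ∏ k ∈ Finset.univ.erase j, Function.update q j (w * q j / z) k i =
        ∏ k ∈ Finset.univ.erase j, q k i :=
      Finset.prod_congr rfl fun k hk => by rw [Function.update_of_ne (Finset.ne_of_mem_erase hk)]
    rw [← h.mul_prod_eq i (h.support_subset_of_isKLProj hz hi),
      ← Finset.mul_prod_erase _ _ (Finset.mem_univ j),
      ← Finset.mul_prod_erase _ _ (Finset.mem_univ j), hrest, Function.update_self, Pi.div_apply,
      Pi.mul_apply, ← mul_assoc, mul_div_cancel₀ _ hi, mul_assoc]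

theorem dualValue_add_le (h : DykstraInvariant C b w q p)
    (hz : IsKLProj (C j) (normalizeVec (w * q j)) z) :
    dualValue q p + klSum z w ≤
      dualValue (Function.update q j (w * q j / z)) (Function.update p j z) := by
  have hzw := h.support_subset_of_isKLProj hz
  have hnormal := (h.correction j).isNormalAt z
    ⟨hz.mem_klDomain.1, hz.mem_klDomain.2.1, hzw.trans (h.correction j).support_subset⟩
  rw [dualValue_update, (h.correction j).dotProduct_log_mul_div hzw]
  rw [sub_dotProduct] at hnormal
  linarith

theorem existsUnique_isKLProj (h : DykstraInvariant C b w q p) (hcl : IsClosed (C j))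
    (hC : Convex ℝ (C j)) (hne : (klDomain (⋂ j, C j) b).Nonempty) :
    ∃! z, IsKLProj (C j) (normalizeVec (w * q j)) z := by
  obtain ⟨v, hv⟩ := hne
  exact _root_.existsUnique_isKLProj hcl hC
    ((h.correction j).normalizeVec_mul_mem_stdSimplex h.mem_stdSimplex).1
    ⟨v, h.mem_klDomain_normalizeVec hv j⟩

end DykstraInvariant

theorem existsUnique_isBregmanDykstra [NeZero J] {C : Fin J → Set (Fin N → ℝ)} {b : Fin N → ℝ}
    (hb : b ∈ stdSimplex ℝ (Fin N)) (hcl : ∀ j, IsClosed (C j)) (hconv : ∀ j, Convex ℝ (C j))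
    (hne : (klDomain (⋂ j, C j) b).Nonempty) :
    ∃! wq : (ℕ → Fin N → ℝ) × (ℕ → Fin J → Fin N → ℝ), IsBregmanDykstra C b wq.1 wq.2 := by
  obtain ⟨f, ⟨hzero, hsucc⟩, huniq⟩ := existsUnique_seq
    (α := (Fin N → ℝ) × (Fin J → Fin N → ℝ)) (fun x => ∃ p, DykstraInvariant C b x.1 x.2 p)
    (fun n x y => IsKLProj (C (Fin.ofNat J n)) (normalizeVec (x.1 * x.2 (Fin.ofNat J n))) y.1 ∧
      y.2 = Function.update x.2 (Fin.ofNat J n) (x.1 * x.2 (Fin.ofNat J n) / y.1))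
    (a := (b, fun _ _ => 1)) ⟨_, .initial C hb⟩
    (fun n x ⟨p, hp⟩ => by
      obtain ⟨z, hz, hzuniq⟩ := hp.existsUnique_isKLProj (hcl (Fin.ofNat J n)) (hconv _) hne
      refine ⟨(z, Function.update x.2 _ (x.1 * x.2 _ / z)), ⟨hz, rfl⟩, fun y hy => ?_⟩
      have hyz : y.1 = z := hzuniq _ hy.1
      exact Prod.ext hyz (hyz ▸ hy.2))
    (fun n x y ⟨p, hp⟩ hy => ⟨_, hy.2 ▸ hp.step (hconv _) hy.1⟩)
  refine ⟨(fun n => (f n).1, fun n => (f n).2), ⟨by simp [hzero], by simp [hzero],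
    fun n => (hsucc n).1, fun n => (hsucc n).2⟩, fun ⟨w, q⟩ h => ?_⟩
  have hf : (fun n => (w n, q n)) = f := huniq _
    ⟨Prod.ext h.w_zero h.q_zero, fun n => ⟨h.w_succ n, h.q_succ n⟩⟩
  simp [← hf]

end DykstraInvariant

section LastProj

variable {J : ℕ} [NeZero J] {E : Type*} {w : ℕ → E}

/-- The last projection of a cyclic method onto each of the `J` sets, before step `n`; where no
projection has been made yet, this is the initial point. -/
def lastProj (J : ℕ) [NeZero J] (w : ℕ → E) : ℕ → Fin J → E
  | 0 => fun _ => w 0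
  | n + 1 => Function.update (lastProj J w n) (Fin.ofNat J n) (w (n + 1))

theorem le_or_exists_lastProj_eq (w : ℕ → E) (n : ℕ) (j : Fin J) :
    n ≤ j ∨ ∃ m, m < n ∧ n ≤ m + J ∧ Fin.ofNat J m = j ∧ lastProj J w n j = w (m + 1) := by
  induction n with
  | zero => exact Or.inl (Nat.zero_le _)
  | succ n ih =>
    rcases eq_or_ne (Fin.ofNat J n) j with hj | hj
    · exact Or.inr ⟨n, by lia, by have := Nat.pos_of_neZero J; lia, hj,
        by rw [lastProj, hj, Function.update_self]⟩
    rcases ih with hlt | ⟨m, hmn, hnm, hmj, heq⟩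
    · refine Or.inl (Nat.lt_of_le_of_ne hlt ?_)
      rintro rfl
      exact hj (by ext; simp)
    · refine Or.inr ⟨m, by lia, Nat.lt_of_le_of_ne hnm ?_, hmj, ?_⟩
      · rintro rfl
        exact hj (by rw [← hmj]; ext; simp)
      · rw [lastProj, Function.update_of_ne hj.symm, heq]

theorem exists_lastProj_eq (w : ℕ → E) {n : ℕ} (hn : J ≤ n) (j : Fin J) :
    ∃ m, m < n ∧ n ≤ m + J ∧ Fin.ofNat J m = j ∧ lastProj J w n j = w (m + 1) :=
  (le_or_exists_lastProj_eq w n j).resolve_left (by have := j.2; lia)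

theorem lastProj_mem {C : Fin J → Set E} (hw : ∀ n, w (n + 1) ∈ C (Fin.ofNat J n)) {n : ℕ}
    (hn : J ≤ n) (j : Fin J) : lastProj J w n j ∈ C j := by
  obtain ⟨m, -, -, rfl, heq⟩ := exists_lastProj_eq w hn j
  exact heq ▸ hw m

variable [PseudoMetricSpace E]

theorem dist_lastProj_le (w : ℕ → E) (n : ℕ) (j : Fin J) :
    dist (lastProj J w (n + J) j) (w (n + J)) ≤
      ∑ i ∈ Finset.range J, dist (w (n + i)) (w (n + i + 1)) := by
  obtain ⟨m, hlt, hle, -, heq⟩ := exists_lastProj_eq w (Nat.le_add_left J n) j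
  rw [heq]
  exact dist_le_sum_range_dist_add w (by lia) hlt le_rfl

theorem tendsto_dist_lastProj (hδ : Tendsto (fun n => dist (w n) (w (n + 1))) atTop (𝓝 0))
    (j : Fin J) : Tendsto (fun n => dist (lastProj J w n j) (w n)) atTop (𝓝 0) := by
  rw [← tendsto_add_atTop_iff_nat J]
  exact squeeze_zero (fun _ => dist_nonneg) (fun n => dist_lastProj_le w n j)
    (tendsto_sum_range_add hδ J)

end LastProj

namespace IsBregmanDykstra

variable {N J : ℕ} [NeZero J] {C : Fin J → Set (Fin N → ℝ)} {b : Fin N → ℝ} {w : ℕ → Fin N → ℝ}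
  {q : ℕ → Fin J → Fin N → ℝ}

theorem dykstraInvariant (h : IsBregmanDykstra C b w q) (hb : b ∈ stdSimplex ℝ (Fin N))
    (hconv : ∀ j, Convex ℝ (C j)) (n : ℕ) :
    DykstraInvariant C b (w n) (q n) (lastProj J w n) := by
  induction n with
  | zero =>
    rw [h.w_zero, h.q_zero, lastProj, h.w_zero]
    exact .initial C hb
  | succ n ih =>
    rw [h.q_succ n]
    exact ih.step (hconv _) (h.w_succ n)

theorem mem_succ (h : IsBregmanDykstra C b w q) (n : ℕ) : w (n + 1) ∈ C (Fin.ofNat J n) :=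
  (h.w_succ n).mem_klDomain.1

theorem isDualAscent (h : IsBregmanDykstra C b w q) (hb : b ∈ stdSimplex ℝ (Fin N))
    (hconv : ∀ j, Convex ℝ (C j)) :
    IsDualAscent C b w fun n => dualValue (q n) (lastProj J w n) where
  w_zero := h.w_zero
  mem_stdSimplex n := (h.dykstraInvariant hb hconv n).mem_stdSimplex
  mem_succ := h.mem_succ
  support_succ n := (h.dykstraInvariant hb hconv n).support_subset_of_isKLProj (h.w_succ n)
  add_klSum_le n := by
    rw [h.q_succ n]
    exact (h.dykstraInvariant hb hconv n).dualValue_add_le (h.w_succ n)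
  support_subset v hv n := (h.dykstraInvariant hb hconv n).support_subset v hv
  klSum_add_le _ hv n := (h.dykstraInvariant hb hconv n).klSum_add_dualValue_le hv

theorem exists_gap_lt_of_isLocallyConical (h : IsBregmanDykstra C b w q)
    (hb : b ∈ stdSimplex ℝ (Fin N)) (hcl : ∀ j, IsClosed (C j)) (hconv : ∀ j, Convex ℝ (C j))
    (hcone : ∀ j, IsLocallyConical (C j)) (hne : (klDomain (⋂ j, C j) b).Nonempty) :
    ∃ y ∈ klDomain (⋂ j, C j) b, ∀ ε > 0,
      ∃ n, klSum y b < dualValue (q n) (lastProj J w n) + ε := by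
  have hinv := h.dykstraInvariant hb hconv
  have hascent := h.isDualAscent hb hconv
  obtain ⟨y, hy, φ, hφ, hlim⟩ := hascent.exists_tendsto_subseq hcl hne tendsto_id
  rw [Function.id_comp] at hlim
  refine ⟨y, hy, fun ε hε => exists_lt_add_of_tendsto hlim ?_ hε⟩
  have hcompl : ∀ᶠ k in atTop, ∀ j,
      0 ≤ (y - lastProj J w (φ k) j) ⬝ᵥ (Real.log ∘ q (φ k) j) := by
    refine eventually_all.2 fun j => ?_
    have hmem : ∀ᶠ k in atTop, lastProj J w (φ k) j ∈ C j :=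
      (hφ.eventually_ge_atTop J).mono fun k hk => lastProj_mem h.mem_succ hk j
    have hlast : Tendsto (fun k => lastProj J w (φ k) j) atTop (𝓝[C j] y) :=
      tendsto_nhdsWithin_iff.2 ⟨(tendsto_iff_of_dist ((tendsto_dist_lastProj
        (tendsto_dist_of_summable_dist_sq (hascent.summable_dist_sq hne)) j).comp hφ)).2 hlim, hmem⟩
    filter_upwards [hlast.eventually (hcone j y (Set.mem_iInter.1 hy.1 j))] with k hk
    have hcorr := (hinv (φ k)).correction j
    exact hcorr.isNormalAt.dotProduct_nonneg hcorr.mem_stdSimplex hy.2.1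
      ((hascent.support_subset y hy _).trans hcorr.support_subset) hk
  filter_upwards [hcompl] with k hk
  rw [(hinv (φ k)).klSum_eq (hascent.support_subset y hy _), add_le_iff_nonpos_right]
  refine Finset.sum_nonpos fun j _ => ?_
  rw [← neg_nonneg, ← neg_dotProduct, neg_sub]
  exact hk j

theorem abs_log_le (h : IsBregmanDykstra C b w q) (hb : b ∈ stdSimplex ℝ (Fin N))
    (hconv : ∀ j, Convex ℝ (C j)) {κ : ℝ} (hκ : 0 < κ) {i : Fin N} (hw : ∀ n, κ ≤ w n i) (n : ℕ)
    (j : Fin J) :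
    |Real.log (q n j i)| ≤ (∑ m ∈ Finset.range n, dist (w m) (w (m + 1))) / κ := by
  induction n with
  | zero => simp [h.q_zero]
  | succ n ih =>
    rw [h.q_succ, Finset.sum_range_succ, add_div]
    rcases eq_or_ne j (Fin.ofNat J n) with rfl | hj
    · have hn : w n i ≠ 0 := (hκ.trans_le (hw n)).ne'
      have hcorr := (h.dykstraInvariant hb hconv n).correction (Fin.ofNat J n)
      have hq := (hcorr.pos_of_ne_zero hn).ne'
      rw [Function.update_self, Pi.div_apply, Pi.mul_apply,
        Real.log_div (mul_ne_zero hn hq) (hκ.trans_le (hw (n + 1))).ne', Real.log_mul hn hq,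
        add_sub_right_comm, add_comm]
      refine (abs_add_le _ _).trans (add_le_add ih ?_)
      refine (abs_log_sub_log_le hκ (hw n) (hw (n + 1))).trans ?_
      gcongr
      exact dist_le_pi_dist (w n) (w (n + 1)) i
    · rw [Function.update_of_ne hj]
      exact ih.trans (le_add_of_nonneg_right (by positivity))

theorem exists_pos_forall_le (h : IsBregmanDykstra C b w q) (hb : b ∈ stdSimplex ℝ (Fin N))
    (hconv : ∀ j, Convex ℝ (C j)) {v : Fin N → ℝ} (hv : v ∈ klDomain (⋂ j, C j) b) :
    ∃ κ > 0, ∀ n i, v i ≠ 0 → κ ≤ w n i := by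
  have hascent := h.isDualAscent hb hconv
  obtain ⟨κ, hκ, hle⟩ := exists_pos_forall_le_of_klSum_le hv.2.1 (klSum v b)
  refine ⟨κ, hκ, fun n => hle _ (hascent.mem_stdSimplex n) (hascent.support_subset v hv n) ?_⟩
  have hzero : dualValue (q 0) (lastProj J w 0) = 0 := by rw [h.q_zero, dualValue_one]
  linarith [hascent.klSum_add_le v hv n, hascent.monotone (Nat.zero_le n)]

theorem klSum_le_dualValue_add (h : IsBregmanDykstra C b w q) (hb : b ∈ stdSimplex ℝ (Fin N))
    (hconv : ∀ j, Convex ℝ (C j)) {κ : ℝ} (hκ : 0 < κ) (hw : ∀ n i, b i ≠ 0 → κ ≤ w n i) (n : ℕ) :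
    klSum (w (n + J)) b ≤ dualValue (q (n + J)) (lastProj J w (n + J)) +
      J * N / κ * ((∑ i ∈ Finset.range J, dist (w (n + i)) (w (n + i + 1))) *
        ∑ m ∈ Finset.range (n + J), dist (w m) (w (m + 1))) := by
  set B := ∑ i ∈ Finset.range J, dist (w (n + i)) (w (n + i + 1))
  set T := ∑ m ∈ Finset.range (n + J), dist (w m) (w (m + 1))
  have hinit : ∀ m, support (w m) ⊆ support b := (h.isDualAscent hb hconv).support_subset_initial
  have hterm : ∀ j i, (lastProj J w (n + J) j - w (n + J)) i * Real.log (q (n + J) j i) ≤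
      B * (T / κ) := fun j i => by
    by_cases hi : b i = 0
    · obtain ⟨m, -, -, -, heq⟩ := exists_lastProj_eq w (Nat.le_add_left J n) j
      rw [heq, Pi.sub_apply, eq_zero_of_support_subset (hinit _) hi,
        eq_zero_of_support_subset (hinit _) hi, sub_self, zero_mul]
      positivity
    · refine (le_abs_self _).trans ((abs_mul _ _).trans_le ?_)
      exact mul_le_mul ((dist_le_pi_dist _ _ i).trans (dist_lastProj_le w n j))
        (h.abs_log_le hb hconv hκ (fun m => hw m i hi) _ j) (abs_nonneg _) (by positivity)
  rw [(h.dykstraInvariant hb hconv (n + J)).klSum_eq subset_rfl, klSum_self, zero_add]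
  gcongr
  calc ∑ j, (lastProj J w (n + J) j - w (n + J)) ⬝ᵥ (Real.log ∘ q (n + J) j)
      ≤ ∑ _j : Fin J, ∑ _i : Fin N, B * (T / κ) :=
        Finset.sum_le_sum fun j _ => Finset.sum_le_sum fun i _ => hterm j i
    _ = J * N / κ * (B * T) := by
        simp only [Finset.sum_const, Finset.card_univ, Fintype.card_fin, nsmul_eq_mul]
        ring

theorem exists_gap_lt_of_support_subset (h : IsBregmanDykstra C b w q)
    (hb : b ∈ stdSimplex ℝ (Fin N)) (hcl : ∀ j, IsClosed (C j)) (hconv : ∀ j, Convex ℝ (C j))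
    {v : Fin N → ℝ} (hv : v ∈ klDomain (⋂ j, C j) b) (hbv : support b ⊆ support v) :
    ∃ y ∈ klDomain (⋂ j, C j) b, ∀ ε > 0,
      ∃ n, klSum y b < dualValue (q n) (lastProj J w n) + ε := by
  have hascent := h.isDualAscent hb hconv
  obtain ⟨κ, hκ, hle⟩ := h.exists_pos_forall_le hb hconv hv
  obtain ⟨φ, hφ, hφsmall⟩ := extraction_forall_of_frequently fun k : ℕ =>
    frequently_sum_mul_sum_lt (hascent.summable_dist_sq ⟨v, hv⟩) J
      (Nat.one_div_pos_of_nat (n := k) (α := ℝ))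
  obtain ⟨y, hy, ψ, hψ, hlim⟩ := hascent.exists_tendsto_subseq hcl ⟨v, hv⟩
    ((tendsto_add_atTop_nat J).comp hφ.tendsto_atTop)
  refine ⟨y, hy, fun ε hε => ?_⟩
  have hkl : Tendsto (fun k => klSum (w (φ (ψ k) + J)) b) atTop (𝓝 (klSum y b)) :=
    ((continuous_klSum_left b).tendsto y).comp hlim
  have herr : Tendsto (fun k => J * N / κ * (1 / ((ψ k : ℝ) + 1))) atTop (𝓝 0) := by
    simpa using ((tendsto_one_div_add_atTop_nhds_zero_nat (𝕜 := ℝ)).comp hψ).const_mul (J * N / κ)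
  have hhalf : klSum y b - ε / 2 < klSum y b := sub_lt_self _ (half_pos hε)
  obtain ⟨k, hkkl, hkerr⟩ := ((hkl.eventually (lt_mem_nhds hhalf)).and
    (herr.eventually (gt_mem_nhds (half_pos hε)))).exists
  refine ⟨φ (ψ k) + J, ?_⟩
  have hbound := h.klSum_le_dualValue_add hb hconv hκ (fun n i hi => hle n i (hbv hi)) (φ (ψ k))
  have hsmall := mul_le_mul_of_nonneg_left (hφsmall (ψ k)).le (by positivity : 0 ≤ J * N / κ)
  linarith

theorem tendsto (h : IsBregmanDykstra C b w q) (hb : b ∈ stdSimplex ℝ (Fin N))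
    (hcl : ∀ j, IsClosed (C j)) (hconv : ∀ j, Convex ℝ (C j))
    (hqual : (∀ j, IsLocallyConical (C j)) ∨
      ∃ v ∈ klDomain (⋂ j, C j) b, support b ⊆ support v)
    {x : Fin N → ℝ} (hx : IsKLProj (⋂ j, C j) b x) : Tendsto w atTop (𝓝 x) := by
  refine (h.isDualAscent hb hconv).tendsto_isKLProj hconv ?_ hx
  rcases hqual with hcone | ⟨v, hv, hbv⟩
  · exact h.exists_gap_lt_of_isLocallyConical hb hcl hconv hcone ⟨x, hx.mem_klDomain⟩
  · exact h.exists_gap_lt_of_support_subset hb hcl hconv hv hbv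

end IsBregmanDykstra

theorem mainTheorem5_general {N : ℕ} (b : Fin N → ℝ) (hb : b ∈ stdSimplex ℝ (Fin N)) :
    (∀ (K : ℕ) [NeZero K] (X : Matrix (Fin N) (Fin K) ℝ) (t : Fin K → ℝ),
      (klDomain {v | X.transpose.mulVec v = t} b).Nonempty →
      ∃ wstar : Fin N → ℝ,
        IsKLProj {v | X.transpose.mulVec v = t} b wstar ∧
        (∀ v, IsKLProj {v | X.transpose.mulVec v = t} b v → v = wstar) ∧
        (∃! w : ℕ → Fin N → ℝ, IsCyclicKLProj X t b w) ∧
        (∀ w : ℕ → Fin N → ℝ, IsCyclicKLProj X t b w → Tendsto w atTop (𝓝 wstar)) ∧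
        (∀ w : ℕ → Fin N → ℝ, IsCyclicTilt X t b w → Tendsto w atTop (𝓝 wstar))) ∧
    (∀ (J : ℕ) [NeZero J] (C : Fin J → Set (Fin N → ℝ)),
      (∀ j, IsClosed (C j)) → (∀ j, Convex ℝ (C j)) →
      (klDomain (⋂ j, C j) b).Nonempty →
      ((∀ j, IsLocallyConical (C j)) ∨ ∃ v ∈ klDomain (⋂ j, C j) b, support b ⊆ support v) →
      ∃ wstar : Fin N → ℝ,
        IsKLProj (⋂ j, C j) b wstar ∧
        (∀ v, IsKLProj (⋂ j, C j) b v → v = wstar) ∧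
        (∃! wq : (ℕ → Fin N → ℝ) × (ℕ → Fin J → Fin N → ℝ), IsBregmanDykstra C b wq.1 wq.2) ∧
        (∀ (w : ℕ → Fin N → ℝ) (q : ℕ → Fin J → Fin N → ℝ),
          IsBregmanDykstra C b w q → Tendsto w atTop (𝓝 wstar))) := by
  refine ⟨fun K _ X t hne => ?_, fun J _ C hcl hconv hne hqual => ?_⟩
  · obtain ⟨x, hx, huniq⟩ := existsUnique_isKLProj (isClosed_setOf_mulVec_eq X t)
      (convex_setOf_mulVec_eq X t) hb.1 hne
    exact ⟨x, hx, huniq, existsUnique_isCyclicKLProj hb hne, fun w hw => hw.tendsto hb hx,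
      fun w hw => (hw.isCyclicKLProj hb).tendsto hb hx⟩
  · obtain ⟨x, hx, huniq⟩ := existsUnique_isKLProj (isClosed_iInter hcl) (convex_iInter hconv)
      hb.1 hne
    exact ⟨x, hx, huniq, existsUnique_isBregmanDykstra hb hcl hconv hne,
      fun w q h => h.tendsto hb hcl hconv hqual hx⟩

theorem mainTheorem5 {N : ℕ} (b : Fin N → ℝ) (hb : b ∈ stdSimplex ℝ (Fin N))
    (hbpos : ∀ i, 0 < b i) :
    -- (i) cyclic one-dimensional KL projections over the equality constraints
    (∀ (K : ℕ) [NeZero K] (X : Matrix (Fin N) (Fin K) ℝ) (t : Fin K → ℝ),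
      (∃ v ∈ stdSimplex ℝ (Fin N), X.transpose.mulVec v = t) →
      ∃ wstar : Fin N → ℝ,
        IsKLProj {v | X.transpose.mulVec v = t} b wstar ∧
        (∀ v, IsKLProj {v | X.transpose.mulVec v = t} b v → v = wstar) ∧
        (∃! w : ℕ → Fin N → ℝ, IsCyclicKLProj X t b w) ∧
        (∀ w : ℕ → Fin N → ℝ, IsCyclicKLProj X t b w → Tendsto w atTop (𝓝 wstar)) ∧
        (∀ w : ℕ → Fin N → ℝ, IsCyclicTilt X t b w → Tendsto w atTop (𝓝 wstar))) ∧
    -- (ii) Bregman-Dykstra with the KL divergence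
    (∀ (J : ℕ) [NeZero J] (C : Fin J → Set (Fin N → ℝ)),
      (∀ j, IsClosed (C j)) → (∀ j, Convex ℝ (C j)) →
      (∃ v ∈ stdSimplex ℝ (Fin N), ∀ j, v ∈ C j) →
      ((∀ j, ∃ (a : Fin N → ℝ) (τ : ℝ), C j = linHyperplane a τ ∨ C j = linHalfspace a τ) ∨
        (∃ v ∈ stdSimplex ℝ (Fin N), (∀ i, 0 < v i) ∧ ∀ j, v ∈ C j)) →
      ∃ wstar : Fin N → ℝ,
        IsKLProj (⋂ j, C j) b wstar ∧
        (∀ v, IsKLProj (⋂ j, C j) b v → v = wstar) ∧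
        (∃! wq : (ℕ → Fin N → ℝ) × (ℕ → Fin J → Fin N → ℝ), IsBregmanDykstra C b wq.1 wq.2) ∧
        (∀ (w : ℕ → Fin N → ℝ) (q : ℕ → Fin J → Fin N → ℝ),
          IsBregmanDykstra C b w q → Tendsto w atTop (𝓝 wstar))) := by
  have hdom : ∀ {C : Set (Fin N → ℝ)}, ∀ v ∈ stdSimplex ℝ (Fin N), v ∈ C → v ∈ klDomain C b :=
    fun v hv hvC => ⟨hvC, hv, fun i _ => (hbpos i).ne'⟩
  obtain ⟨hcyclic, hdykstra⟩ := mainTheorem5_general b hb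
  refine ⟨fun K _ X t ⟨v, hv, hvt⟩ => hcyclic K X t ⟨v, hdom v hv hvt⟩,
    fun J _ C hcl hconv ⟨v, hv, hvC⟩ hqual => hdykstra J C hcl hconv
      ⟨v, hdom v hv (Set.mem_iInter.2 hvC)⟩ (hqual.imp (fun hpoly j => ?_) ?_)⟩
  · exact isLocallyConical_of_eq_linHyperplane_or_linHalfspace (hpoly j)
  · rintro ⟨u, hu, hupos, huC⟩
    exact ⟨u, hdom u hu (Set.mem_iInter.2 huC), fun i _ => (hupos i).ne'⟩
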